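/- Fix an integer $d\ge1$, real numbers $J\in\mathbb R$, $\beta\in(0,\infty)$ and $s\in(d,d+1]$, and let $K_{i,j}=|i-j|^{-s}$ for $i\neq j$ in $\mathbb Z^d$ (Euclidean distance) and $K_{i,i}=0$. Consider the Ising model with configurations $\sigma\in\{+1,-1\}^{\mathbb Z^d}$ and formal Hamiltonian \[ H=-\sum_{\langle i,j\rangle}J\sigma_i\sigma_j+\frac12\sum_{i,j}K_{i,j}\sigma_i\sigma_j, \] where $\langle i,j\rangle$ runs over the unordered nearest-neighbor pairs and $i,j$ over all ordered pairs of sites. For finite $\Lambda\subset\mathbb Z^d$ let $H_\Lambda(\sigma)=H_\Lambda(\sigma_\Lambda,\sigma_{\Lambda^{\mathrm c}})$ be obtained from $H$ by dropping all terms with both $i$ and $j$ outside $\Lambda$. A Gibbs measure at inverse temperature $\beta$ is a probability measure $\mu$ on $\{+1,-1\}^{\mathbb Z^d}$ with the product $\sigma$-algebra such that, for every finite $\Lambda$, the conditional distribution of $\sigma_\Lambda$ given $\sigma_{\Lambda^{\mathrm c}}$ is $\mu$-almost surely $Z_\Lambda(\sigma_{\Lambda^{\mathrm c}})^{-1}\mathrm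 e^{-\beta H_\Lambda(\sigma_\Lambda,\sigma_{\Lambda^{\mathrm c}})}$, where $Z_\Lambda(\sigma_{\Lambda^{\mathrm c}})=\sum_{\sigma_\Lambda}\mathrm e^{-\beta H_\Lambda(\sigma_\Lambda,\sigma_{\Lambda^{\mathrm c}})}$. Let $\Lambda_L=[-L,L]^d\cap\mathbb Z^d$ for $L\in\mathbb N$. Let $\mu$ be any such Gibbs measure. Then: (1) For each $\epsilon>0$ there exists $\delta>0$ such that for all sufficiently large $L$ and $\mu$-almost every boundary condition $\sigma_{\Lambda_L^{\mathrm c}}$, \[ \mu\Bigl(\Bigl|\sum_{i\in\Lambda_L}\sigma_i\Bigr|>\epsilon|\Lambda_L|\Bigm|\sigma_{\Lambda_L^{\mathrm c}}\Bigr)\le\mathrm e^{-\delta|\Lambda_L|}. \] (2) For $\mu$-almost every $\sigma$, $\displaystyle\lim_{L\to\infty}\frac1{|\Lambda_L|}\sum_{i\in\Lambda_L}\sigma_i=0$. (3) If $\mu$ is translation invariant, then the expectation of the spin $\sigma_0$ at the origin under $\mu$ is $0$. -/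

import Mathlib

open MeasureTheory ProbabilityTheory Filter Topology

noncomputable section

namespace LongRangeIsing

/-- The sites of the lattice `ℤ^d`. -/
abbrev Site (d : ℕ) : Type := Fin d → ℤ

/-- Spin configurations: `ℤˣ` is the two-point set `{1, -1}`. The measurable structure is the
product sigma-algebra. -/
abbrev Config (d : ℕ) : Type := Site d → ℤˣ

/-- The value of the spin at the site `i`, as a real number. -/
def spin {d : ℕ} (σ : Config d) (i : Site d) : ℝ := ((σ i : ℤ) : ℝ)

/-- The Euclidean distance of two sites. -/
def euclDist {d : ℕ} (i j : Site d) : ℝ := √(∑ k, ((i k : ℝ) - (j k : ℝ)) ^ 2)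

/-- The long-range coupling `K_{i,j} = |i - j|^{-s}`, with `K_{i,i} = 0`. -/
def longRange {d : ℕ} (s : ℝ) (i j : Site d) : ℝ :=
  if i = j then 0 else 1 / euclDist i j ^ s

/-- Nearest neighbours in `ℤ^d`. -/
def IsNearestNeighbor {d : ℕ} (i j : Site d) : Prop := ∑ k, |i k - j k| = 1

open Classical in
/-- The nearest-neighbour part `-J ∑_{⟨i,j⟩} σ_i σ_j` of the Hamiltonian in `Λ`, without the terms
that have both sites outside `Λ`. Each unordered pair `⟨i,j⟩` occurs as two ordered pairs, whence
the factor `1 / 2`; only finitely many terms are nonzero. -/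
def nearestNeighborEnergy {d : ℕ} (J : ℝ) (Λ : Finset (Site d)) (σ : Config d) : ℝ :=
  -((1 / 2) * ∑' p : Site d × Site d,
    if IsNearestNeighbor p.1 p.2 ∧ (p.1 ∈ Λ ∨ p.2 ∈ Λ) then J * spin σ p.1 * spin σ p.2 else 0)

open Classical in
/-- The long-range part `(1/2) ∑_{i,j} K_{i,j} σ_i σ_j` of the Hamiltonian in `Λ`, without the terms
that have both sites outside `Λ`. The series converges absolutely for `s > d`. -/
def longRangeEnergy {d : ℕ} (s : ℝ) (Λ : Finset (Site d)) (σ : Config d) : ℝ :=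
  (1 / 2) * ∑' p : Site d × Site d,
    if p.1 ∈ Λ ∨ p.2 ∈ Λ then longRange s p.1 p.2 * spin σ p.1 * spin σ p.2 else 0

/-- The Hamiltonian `H_Λ` in the finite volume `Λ`. -/
def hamiltonian {d : ℕ} (J s : ℝ) (Λ : Finset (Site d)) (σ : Config d) : ℝ :=
  nearestNeighborEnergy J Λ σ + longRangeEnergy s Λ σ

/-- The configuration that is `τ` in `Λ` and `σ` outside `Λ`. -/
def glue {d : ℕ} {Λ : Finset (Site d)} (τ : Λ → ℤˣ) (σ : Config d) : Config d :=
  fun i => if h : i ∈ Λ then τ ⟨i, h⟩ else σ i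

/-- The partition function `Z_Λ` with boundary condition `σ` outside `Λ`. -/
def partitionFunction {d : ℕ} (J s β : ℝ) (Λ : Finset (Site d)) (σ : Config d) : ℝ :=
  ∑ τ : Λ → ℤˣ, Real.exp (-β * hamiltonian J s Λ (glue τ σ))

/-- The Gibbs-Boltzmann probability of `τ` in `Λ` with boundary condition `σ` outside `Λ`. -/
def gibbsProb {d : ℕ} (J s β : ℝ) (Λ : Finset (Site d)) (τ : Λ → ℤˣ) (σ : Config d) : ℝ :=
  (partitionFunction J s β Λ σ)⁻¹ * Real.exp (-β * hamiltonian J s Λ (glue τ σ))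

/-- The sigma-algebra generated by the spins outside `Λ`. -/
abbrev exterior {d : ℕ} (Λ : Finset (Site d)) : MeasurableSpace (Config d) :=
  cylinderEvents (X := fun _ : Site d => ℤˣ) ((Λ : Set (Site d))ᶜ)

/-- Infinite-volume Gibbs measures: probability measures on `{1, -1}^{ℤ^d}` such that, for all
finite `Λ`, the conditional distribution of the spins in the (finite) set `Λ` given the spins
outside `Λ` is the Gibbs-Boltzmann one. -/
structure IsGibbsMeasure {d : ℕ} (J s β : ℝ) (μ : Measure (Config d)) : Prop where
  isProbabilityMeasure : IsProbabilityMeasure μ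
  dlr : ∀ (Λ : Finset (Site d)) (τ : Λ → ℤˣ),
    μ⟦{σ : Config d | ∀ i : Λ, σ i = τ i} | exterior Λ⟧ =ᵐ[μ] gibbsProb J s β Λ τ

/-- The translate of a configuration by `a`. -/
def shiftConfig {d : ℕ} (a : Site d) (σ : Config d) : Config d := fun i => σ (i + a)

/-- Translation invariance of a measure on configurations. -/
def IsTranslationInvariant {d : ℕ} (μ : Measure (Config d)) : Prop :=
  ∀ a : Site d, μ.map (shiftConfig a) = μ

/-- The box `Λ_L = [-L, L]^d ∩ ℤ^d`. -/
def box (d L : ℕ) : Finset (Site d) :=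
  Fintype.piFinset fun _ => Finset.Icc (-(L : ℤ)) (L : ℤ)

end LongRangeIsing

end

open LongRangeIsing

namespace LongRangeIsing

/-! ### The lattice -/

/-! Write the energy as `½ ∑ w(i,j) σ_i σ_j` with `w` = `coupling`. Multiply the spins by
independent random signs `η` with `𝔼 η_i η_j = r(i,j) = exp (-l |i - j|)`. Flips permute the
configurations, so by Jensen the partition function of the averaged couplings `w r` is at most that
of `w` (`sum_exp_mul_signCov_le`). Configurations for which averaging lowers the energy by at least
`q / 2` therefore have Gibbs weight at most `exp (-β q / 2)`, up to boundary effects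
(`sum_gibbsProb_le`).

It remains to see that a magnetization density `t` forces a gain of order `|Λ|`. The gain is
governed by `w (1 - r)`, whose main part is `(1 - exp (-l y)) y ^ (-s)` at distance `y`. Up to
errors linear in `l` per site, this is `smoothKernel`, a positive mixture of exponentials, hence
positive semidefinite. Positivity applied to `σ - t` shows that its quadratic form is at least `g t²
|Λ|` minus a surface term, with `g` the total mass of the kernel (`quadForm_smoothKernel_ge`). As `l
→ 0`, `g / l` is unbounded, because `∑ |x| ^ (1 - s)` diverges for `s ≤ d + 1`
(`exists_le_tsum_smoothKernel`). So for small `l` the gain beats all errors of order `l |Λ|`,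
including the nearest-neighbour term, whatever `J` and `β` are. Since `s > d`, surface terms are
`o(|Λ|)`.

That `exp (-l |x - y|)` is a covariance of signs comes from random hyperplane cuts
(`exp_neg_norm_mem_signCov`). The almost sure limit follows by Borel–Cantelli, and the mean spin by
dominated convergence. -/

/-- The point of Euclidean space at the site `x`. -/
noncomputable def siteVec {d : ℕ} (x : Site d) : EuclideanSpace ℝ (Fin d) :=
  WithLp.toLp 2 fun k => (x k : ℝ)

theorem euclDist_eq_norm {d : ℕ} (i j : Site d) : euclDist i j = ‖siteVec i - siteVec j‖ := by
  rw [EuclideanSpace.norm_eq]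
  simp [euclDist, siteVec, sq_abs]

theorem euclDist_sub {d : ℕ} (i j : Site d) : euclDist (i - j) 0 = euclDist i j := by
  simp [euclDist]

theorem euclDist_comm {d : ℕ} (i j : Site d) : euclDist i j = euclDist j i := by
  rw [euclDist_eq_norm, euclDist_eq_norm, norm_sub_rev]

theorem euclDist_self {d : ℕ} (i : Site d) : euclDist i i = 0 := by
  simp [euclDist]

theorem euclDist_nonneg {d : ℕ} (i j : Site d) : 0 ≤ euclDist i j := Real.sqrt_nonneg _

theorem one_le_euclDist {d : ℕ} {i j : Site d} (h : i ≠ j) : 1 ≤ euclDist i j := by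
  obtain ⟨k, hk⟩ := Function.ne_iff.mp h
  have h1 : (1 : ℝ) ≤ ((i k : ℝ) - (j k : ℝ)) ^ 2 := by
    have : (1 : ℤ) ≤ (i k - j k) ^ 2 := by
      have h0 : i k - j k ≠ 0 := sub_ne_zero.mpr hk
      have := sq_pos_of_ne_zero h0
      omega
    exact_mod_cast this
  rw [euclDist, Real.one_le_sqrt]
  exact h1.trans (Finset.single_le_sum (f := fun k => ((i k : ℝ) - (j k : ℝ)) ^ 2)
    (fun _ _ => sq_nonneg _) (Finset.mem_univ k))

theorem longRange_sub {d : ℕ} (s : ℝ) (i j : Site d) :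
    longRange s (i - j) 0 = longRange s i j := by
  simp [longRange, euclDist_sub, sub_eq_zero]

theorem longRange_comm {d : ℕ} (s : ℝ) (i j : Site d) : longRange s i j = longRange s j i := by
  simp [longRange, euclDist_comm i j, eq_comm]

theorem longRange_nonneg {d : ℕ} (s : ℝ) (i j : Site d) : 0 ≤ longRange s i j := by
  unfold longRange
  have := euclDist_nonneg i j
  split_ifs <;> positivity

theorem longRange_self {d : ℕ} (s : ℝ) (i : Site d) : longRange s i i = 0 := by
  simp [longRange]

theorem longRange_of_ne {d : ℕ} (s : ℝ) {i j : Site d} (h : i ≠ j) :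
    longRange s i j = euclDist i j ^ (-s) := by
  rw [longRange, if_neg h, Real.rpow_neg (euclDist_nonneg i j), one_div]

theorem IsNearestNeighbor.ne {d : ℕ} {i j : Site d} (h : IsNearestNeighbor i j) : i ≠ j := by
  rintro rfl
  simp [IsNearestNeighbor] at h

theorem IsNearestNeighbor.euclDist_eq_one {d : ℕ} {i j : Site d} (h : IsNearestNeighbor i j) :
    euclDist i j = 1 := by
  refine le_antisymm ?_ (one_le_euclDist h.ne)
  have h' : ∑ k, |(i k : ℝ) - (j k : ℝ)| = 1 := by exact_mod_cast h
  rw [euclDist, Real.sqrt_le_iff, one_pow, ← h']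
  refine ⟨by positivity, ?_⟩
  refine Finset.sum_le_sum fun k _ => ?_
  rw [← sq_abs, sq]
  refine mul_le_of_le_one_left (abs_nonneg _) (h' ▸ ?_)
  exact Finset.single_le_sum (f := fun k => |(i k : ℝ) - (j k : ℝ)|)
    (fun _ _ => abs_nonneg _) (Finset.mem_univ k)

theorem IsNearestNeighbor.longRange_eq_one {d : ℕ} {i j : Site d} (h : IsNearestNeighbor i j)
    (s : ℝ) : longRange s i j = 1 := by
  rw [longRange_of_ne s h.ne, h.euclDist_eq_one, Real.one_rpow]

theorem summable_euclDist_rpow {d : ℕ} {s : ℝ} (hs : (d : ℝ) < s) :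
    Summable fun x : Site d => euclDist x 0 ^ (-s) := by
  let b := (EuclideanSpace.basisFun (Fin d) ℝ).toBasis
  let L : Submodule ℤ (EuclideanSpace ℝ (Fin d)) := Submodule.span ℤ (Set.range b)
  have hmem : ∀ x : Site d, siteVec x ∈ L := by
    intro x
    have : siteVec x = ∑ k, x k • b k := by
      ext k
      simp [siteVec, b, Finset.sum_apply, Pi.single_apply]
    rw [this]
    exact Submodule.sum_mem _ fun k _ => Submodule.smul_mem _ _ (Submodule.subset_span ⟨k, rfl⟩)
  have hinj : Function.Injective fun x : Site d => (⟨siteVec x, hmem x⟩ : L) := by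
    intro x y hxy
    have h2 : siteVec x = siteVec y := congrArg Subtype.val hxy
    funext k
    have h3 := congrArg (fun v : EuclideanSpace ℝ (Fin d) => v k) h2
    simpa [siteVec] using h3
  have hrank : Module.finrank ℤ L = d := by
    rw [ZLattice.rank ℝ L]
    simp
  have := (ZLattice.summable_norm_rpow L (-s) (by rw [hrank]; linarith)).comp_injective hinj
  refine this.congr fun x => ?_
  rw [euclDist_eq_norm]
  simp only [Function.comp_apply, Submodule.coe_norm]
  congr 2
  ext k
  simp [siteVec]

theorem summable_longRange_zero {d : ℕ} {s : ℝ} (hs : (d : ℝ) < s) :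
    Summable fun x : Site d => longRange s x 0 := by
  refine (summable_euclDist_rpow hs).of_nonneg_of_le (fun x => longRange_nonneg s x 0) fun x => ?_
  by_cases h : x = 0
  · rw [h, longRange_self]
    exact Real.rpow_nonneg (euclDist_nonneg _ _) _
  · rw [longRange_of_ne s h]

/-- Comparison with the harmonic series: with `d = e + 1`, the `(n + 1) ^ e` sites with first
coordinate `n + 1` and the others in `[0, n]` lie at distance at most `d (n + 1)`, so together they
contribute at least a constant times `1 / (n + 1)`. -/
theorem not_summable_euclDist_rpow {d : ℕ} (hd : 1 ≤ d) {p : ℝ} (hpd : p ≤ d) :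
    ¬ Summable fun x : Site d => euclDist x 0 ^ (-p) := by
  obtain ⟨e, rfl⟩ : ∃ e, d = e + 1 := ⟨d - 1, by omega⟩
  intro h
  let f : (Σ n : ℕ, Fin e → Fin (n + 1)) → Site (e + 1) :=
    fun q => Fin.cons ((q.1 : ℤ) + 1) fun k => ((q.2 k : ℕ) : ℤ)
  have hf : Function.Injective f := by
    rintro ⟨n, v⟩ ⟨m, w⟩ hvw
    have h0 := congrFun hvw 0
    have hnm : n = m := by simpa [f] using h0
    subst hnm
    congr 1
    funext k
    have hk := congrFun hvw k.succ
    exact Fin.ext (by simpa [f] using hk)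
  have h1 := (h.comp_injective hf).sigma
  have hc : ∀ q, ((e : ℝ) + 1) ^ (-((e : ℝ) + 1)) * ((q.1 : ℝ) + 1) ^ (-((e : ℝ) + 1))
      ≤ euclDist (f q) 0 ^ (-p) := by
    rintro ⟨n, v⟩
    have hne : f ⟨n, v⟩ ≠ 0 := by
      intro h0
      have := congrFun h0 0
      simp only [f, Fin.cons_zero, Pi.zero_apply] at this
      omega
    have h1 := one_le_euclDist hne
    have hle : euclDist (f ⟨n, v⟩) 0 ≤ ((e : ℝ) + 1) * ((n : ℝ) + 1) := by
      rw [euclDist]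
      refine Real.sqrt_le_iff.mpr ⟨by positivity, ?_⟩
      have : ∀ k, ((f ⟨n, v⟩ k : ℝ) - ((0 : Site (e + 1)) k : ℝ)) ^ 2 ≤ ((n : ℝ) + 1) ^ 2 := by
        intro k
        refine Fin.cases ?_ (fun k => ?_) k
        · simp [f]
        · have hv : ((v k : ℕ) : ℝ) ≤ n := by
            have := (v k).is_lt
            exact_mod_cast Nat.lt_succ_iff.mp this
          have h0 : (0 : ℝ) ≤ ((v k : ℕ) : ℝ) := by positivity
          simp only [f, Fin.cons_succ, Pi.zero_apply, Int.cast_natCast, Int.cast_zero, sub_zero]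
          gcongr
          linarith
      calc _ ≤ ∑ _k : Fin (e + 1), ((n : ℝ) + 1) ^ 2 := Finset.sum_le_sum fun k _ => this k
        _ = ((e : ℝ) + 1) * ((n : ℝ) + 1) ^ 2 := by simp
        _ ≤ ((e : ℝ) + 1) ^ 2 * ((n : ℝ) + 1) ^ 2 := by
          gcongr
          nlinarith [(Nat.cast_nonneg e : (0 : ℝ) ≤ e)]
        _ = _ := by ring
    rw [← Real.mul_rpow (by positivity) (by positivity)]
    calc _ ≤ euclDist (f ⟨n, v⟩) 0 ^ (-((e : ℝ) + 1)) :=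
          Real.rpow_le_rpow_of_nonpos (by linarith) hle (by linarith [(Nat.cast_nonneg e : (0 : ℝ) ≤ e)])
      _ ≤ _ := Real.rpow_le_rpow_of_exponent_le h1 (by push_cast at hpd; linarith)
  have h2 : Summable fun n : ℕ => ((e : ℝ) + 1) ^ (-((e : ℝ) + 1)) * (1 / ((n : ℝ) + 1)) := by
    refine h1.of_nonneg_of_le (fun n => by positivity) fun n => ?_
    rw [tsum_fintype]
    calc _ = ∑ _v : Fin e → Fin (n + 1),
          ((e : ℝ) + 1) ^ (-((e : ℝ) + 1)) * ((n : ℝ) + 1) ^ (-((e : ℝ) + 1)) := by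
          rw [Finset.sum_const, Finset.card_univ, Fintype.card_fun, Fintype.card_fin,
            Fintype.card_fin, nsmul_eq_mul, neg_add, Real.rpow_add (by positivity : (0 : ℝ) < n + 1),
            Real.rpow_neg_one, Real.rpow_neg (by positivity : (0 : ℝ) ≤ n + 1), Real.rpow_natCast]
          push_cast
          field_simp
      _ ≤ _ := Finset.sum_le_sum fun v _ => hc ⟨n, v⟩
  have h3 := (summable_mul_left_iff (by positivity)).mp h2
  have h4 : Summable fun n : ℕ => 1 / ((n : ℝ)) := by
    rw [← summable_nat_add_iff 1]
    exact_mod_cast h3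
  exact Real.not_summable_one_div_natCast h4

/-! ### Surface effects -/

/-- The total long-range coupling between `Λ` and its complement. -/
noncomputable def surfaceCoupling {d : ℕ} (s : ℝ) (Λ : Finset (Site d)) : ℝ :=
  ∑ i ∈ Λ, ∑' j, if j ∈ Λ then 0 else longRange s i j

theorem summable_longRange {d : ℕ} {s : ℝ} (hs : (d : ℝ) < s) (i : Site d) :
    Summable fun j : Site d => longRange s i j := by
  have := (Equiv.subLeft i).summable_iff.mpr (summable_longRange_zero hs)
  refine this.congr fun j => ?_
  simp [longRange_sub]

theorem tsum_longRange {d : ℕ} (s : ℝ) (i : Site d) :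
    ∑' j : Site d, longRange s i j = ∑' x : Site d, longRange s x 0 := by
  rw [← (Equiv.subLeft i).tsum_eq (fun x : Site d => longRange s x 0)]
  simp [longRange_sub]

/-- Grouping pairs by their difference `x` puts all dependence on `Λ` into a boundary count with `x`
fixed, ready for dominated convergence. -/
theorem surfaceCoupling_eq_tsum {d : ℕ} {s : ℝ} (hs : (d : ℝ) < s) (Λ : Finset (Site d)) :
    surfaceCoupling s Λ = ∑' x, longRange s x 0 * ({i ∈ Λ | i - x ∉ Λ}.card : ℝ) := by
  have h1 : ∀ i, (∑' j, if j ∈ Λ then 0 else longRange s i j) =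
      ∑' x, if i - x ∈ Λ then 0 else longRange s x 0 := by
    intro i
    rw [← (Equiv.subLeft i).tsum_eq (fun x : Site d => if i - x ∈ Λ then 0 else longRange s x 0)]
    simp [longRange_sub]
  simp only [surfaceCoupling, h1]
  rw [← Summable.tsum_finsetSum]
  · refine tsum_congr fun x => ?_
    rw [Finset.card_filter]
    push_cast
    rw [Finset.mul_sum]
    refine Finset.sum_congr rfl fun i _ => ?_
    split_ifs <;> simp_all
  · intro i _
    refine (summable_longRange_zero hs).of_nonneg_of_le (fun x => ?_) (fun x => ?_)
    · split_ifs
      exacts [le_rfl, longRange_nonneg s x 0]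
    · split_ifs
      exacts [longRange_nonneg s x 0, le_rfl]

theorem card_box (d L : ℕ) : (box d L).card = (2 * L + 1) ^ d := by
  rw [box, Fintype.card_piFinset_const, Int.card_Icc]
  congr 1
  omega

theorem tendsto_card_box_boundary {d : ℕ} (x : Site d) :
    Tendsto (fun L : ℕ => ({i ∈ box d L | i - x ∉ box d L}.card : ℝ) / ((box d L).card : ℝ))
      atTop (𝓝 0) := by
  set m : ℕ := ∑ k, (x k).natAbs with hm
  have hxm : ∀ k, |x k| ≤ m := by
    intro k
    rw [Int.abs_eq_natAbs]
    exact_mod_cast Finset.single_le_sum (f := fun k => (x k).natAbs) (fun _ _ => Nat.zero_le _)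
      (Finset.mem_univ k)
  have hbound : ∀ L, m ≤ L → ({i ∈ box d L | i - x ∉ box d L}.card : ℝ) / ((box d L).card : ℝ)
      ≤ 1 - (1 - 2 * m / (2 * L + 1 : ℝ)) ^ d := by
    intro L hL
    -- Since `m` bounds every coordinate of `x`, a shift by `x` cannot leave the larger box.
    have hsub : box d (L - m) ⊆ {i ∈ box d L | i - x ∈ box d L} := by
      intro i hi
      simp only [box, Finset.mem_filter, Fintype.mem_piFinset, Finset.mem_Icc, Pi.sub_apply] at hi ⊢
      push_cast [hL] at hi
      refine ⟨fun k => ?_, fun k => ?_⟩ <;>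
      · have h1 := hi k
        have h2 := abs_le.mp (hxm k)
        constructor <;> omega
    have hcard := Finset.card_le_card hsub
    have hadd := Finset.card_filter_add_card_filter_not (s := box d L) (fun i => i - x ∈ box d L)
    have hpos : (0 : ℝ) < (box d L).card := by
      rw [card_box]
      positivity
    rw [div_le_iff₀ hpos]
    have e1 : (1 - 2 * m / (2 * L + 1 : ℝ)) ^ d * ((box d L).card : ℝ) = (box d (L - m)).card := by
      rw [card_box, card_box]
      push_cast [hL]
      rw [← mul_pow]
      congr 1
      field_simp
      ring
    rw [sub_mul, one_mul, e1, le_sub_iff_add_le]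
    have : {i ∈ box d L | i - x ∉ box d L}.card + (box d (L - m)).card ≤ (box d L).card := by omega
    exact_mod_cast this
  have hlim : Tendsto (fun L : ℕ => 1 - (1 - 2 * m / (2 * L + 1 : ℝ)) ^ d) atTop (𝓝 0) := by
    have h1 : Tendsto (fun L : ℕ => (2 * L + 1 : ℝ)) atTop atTop :=
      tendsto_atTop_add_const_right _ _
        (tendsto_natCast_atTop_atTop.const_mul_atTop (by norm_num))
    have h2 := ((h1.const_div_atTop (2 * (m : ℝ))).const_sub 1).pow d |>.const_sub 1
    simpa using h2
  refine tendsto_of_tendsto_of_tendsto_of_le_of_le' tendsto_const_nhds hlim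
    (Eventually.of_forall fun L => by positivity) ?_
  filter_upwards [eventually_ge_atTop m] with L hL using hbound L hL

theorem tendsto_surfaceCoupling_box {d : ℕ} {s : ℝ} (hs : (d : ℝ) < s) :
    Tendsto (fun L : ℕ => surfaceCoupling s (box d L) / ((box d L).card : ℝ)) atTop (𝓝 0) := by
  have h := tendsto_tsum_of_dominated_convergence (𝓕 := (atTop : Filter ℕ))
    (f := fun (L : ℕ) (x : Site d) => longRange s x 0 *
      (({i ∈ box d L | i - x ∉ box d L}.card : ℝ) / ((box d L).card : ℝ)))
    (g := fun _ => 0) (summable_longRange_zero hs) (fun x => by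
      simpa using (tendsto_card_box_boundary x).const_mul (longRange s x 0))
    (Eventually.of_forall fun L x => by
      rw [Real.norm_of_nonneg (mul_nonneg (longRange_nonneg s x 0) (by positivity))]
      refine mul_le_of_le_one_right (longRange_nonneg s x 0) (div_le_one_of_le₀ ?_ (by positivity))
      exact_mod_cast Finset.card_filter_le _ _)
  rw [tsum_zero] at h
  refine h.congr fun L => ?_
  rw [surfaceCoupling_eq_tsum hs, ← tsum_div_const]
  simp only [mul_div_assoc]

/-! ### Covariance matrices of random signs -/

/-- The covariance matrices `𝔼[η_i η_j]` of random signs `η : ι → {1, -1}`. -/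
def signCov (ι : Type*) : Set (ι → ι → ℝ) :=
  convexHull ℝ (Set.range fun (η : ι → ℤˣ) (i j : ι) => ((η i : ℤ) : ℝ) * ((η j : ℤ) : ℝ))

theorem units_sq (u : ℤˣ) : ((u : ℤ) : ℝ) * ((u : ℤ) : ℝ) = 1 := by
  rcases Int.units_eq_one_or u with h | h <;> simp [h]

theorem abs_units (u : ℤˣ) : |((u : ℤ) : ℝ)| = 1 := by
  rcases Int.units_eq_one_or u with h | h <;> simp [h]

theorem sign_mem_signCov {ι : Type*} (η : ι → ℤˣ) :
    (fun i j => ((η i : ℤ) : ℝ) * ((η j : ℤ) : ℝ)) ∈ signCov ι :=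
  subset_convexHull ℝ _ ⟨η, rfl⟩

theorem signCov_subset {ι : Type*} {S : Set (ι → ι → ℝ)} (hS : Convex ℝ S)
    (h : ∀ η : ι → ℤˣ, (fun i j => ((η i : ℤ) : ℝ) * ((η j : ℤ) : ℝ)) ∈ S) : signCov ι ⊆ S :=
  convexHull_min (by rintro _ ⟨η, rfl⟩; exact h η) hS

theorem convex_signCov (ι : Type*) : Convex ℝ (signCov ι) := convex_convexHull ℝ _

theorem isClosed_signCov (ι : Type*) [Finite ι] : IsClosed (signCov ι) :=
  (Set.finite_range _).isClosed_convexHull ℝ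

theorem one_mem_signCov (ι : Type*) : (1 : ι → ι → ℝ) ∈ signCov ι := by
  convert sign_mem_signCov (ι := ι) (fun _ => 1) using 1
  ext
  simp

/-- The product of two independent families of random signs is again a family of random signs.
Formally, the claim is checked on deterministic signs and extended by convexity in each factor in
turn. -/
theorem mul_mem_signCov {ι : Type*} {r q : ι → ι → ℝ} (hr : r ∈ signCov ι) (hq : q ∈ signCov ι) :
    r * q ∈ signCov ι := by
  have h1 : ∀ η : ι → ℤˣ, signCov ι ⊆
      {q | (fun i j => ((η i : ℤ) : ℝ) * ((η j : ℤ) : ℝ)) * q ∈ signCov ι} := fun η =>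
    signCov_subset ((convex_signCov ι).linear_preimage
      (LinearMap.mulLeft ℝ (fun i j => ((η i : ℤ) : ℝ) * ((η j : ℤ) : ℝ)))) fun ξ => by
      have h : (fun i j => ((η i : ℤ) : ℝ) * ((η j : ℤ) : ℝ)) *
          (fun i j => ((ξ i : ℤ) : ℝ) * ((ξ j : ℤ) : ℝ)) =
          fun i j => (((η i * ξ i : ℤˣ) : ℤ) : ℝ) * (((η j * ξ j : ℤˣ) : ℤ) : ℝ) := by
        ext i j
        simp
        ring
      rw [Set.mem_ofPred_eq, h]
      exact sign_mem_signCov (fun i => η i * ξ i)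
  have h2 : signCov ι ⊆ {r | r * q ∈ signCov ι} :=
    signCov_subset ((convex_signCov ι).linear_preimage (LinearMap.mulRight ℝ q)) fun η => h1 η hq
  exact h2 hr

theorem pow_mem_signCov {ι : Type*} {r : ι → ι → ℝ} (hr : r ∈ signCov ι) (n : ℕ) :
    r ^ n ∈ signCov ι := by
  induction n with
  | zero => simpa using one_mem_signCov ι
  | succ n ih => simpa [pow_succ] using mul_mem_signCov ih hr

/-- The sum `∑ k(i,j) v_i v_j`. -/
def quadForm {ι : Type*} [Fintype ι] (k : ι → ι → ℝ) (v : ι → ℝ) : ℝ :=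
  ∑ i, ∑ j, k i j * v i * v j

theorem quadForm_nonneg_of_mem_signCov {ι : Type*} [Fintype ι] {r : ι → ι → ℝ}
    (hr : r ∈ signCov ι) (v : ι → ℝ) : 0 ≤ quadForm r v := by
  have : signCov ι ⊆ {r | 0 ≤ quadForm r v} := by
    refine signCov_subset ?_ fun η => ?_
    · intro x hx y hy a b ha hb _
      simp only [Set.mem_ofPred_eq] at hx hy ⊢
      have : quadForm (a • x + b • y) v = a * quadForm x v + b * quadForm y v := by
        simp only [quadForm, Pi.add_apply, Pi.smul_apply, smul_eq_mul, Finset.mul_sum,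
          ← Finset.sum_add_distrib]
        refine Finset.sum_congr rfl fun i _ => Finset.sum_congr rfl fun j _ => by ring
      rw [this]
      positivity
    · have : quadForm (fun i j => ((η i : ℤ) : ℝ) * ((η j : ℤ) : ℝ)) v =
          (∑ i, ((η i : ℤ) : ℝ) * v i) ^ 2 := by
        rw [sq, Finset.sum_mul_sum]
        refine Finset.sum_congr rfl fun i _ => Finset.sum_congr rfl fun j _ => by ring
      simp only [Set.mem_ofPred_eq, this]
      positivity
  exact this hr

/-- Randomly flipping the spins of a finite system decreases its partition function if the
Hamiltonian is replaced by its average over the flips. -/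
theorem sum_exp_mul_signCov_le {ι : Type*} [Fintype ι] [DecidableEq ι] (b : ℝ) (w : ι → ι → ℝ)
    {r : ι → ι → ℝ} (hr : r ∈ signCov ι) :
    ∑ τ : ι → ℤˣ, Real.exp (b * quadForm (w * r) fun i => ((τ i : ℤ) : ℝ)) ≤
      ∑ τ : ι → ℤˣ, Real.exp (b * quadForm w fun i => ((τ i : ℤ) : ℝ)) := by
  set Z := ∑ τ : ι → ℤˣ, Real.exp (b * quadForm w fun i => ((τ i : ℤ) : ℝ)) with hZ
  have : signCov ι ⊆
      {r | ∑ τ : ι → ℤˣ, Real.exp (b * quadForm (w * r) fun i => ((τ i : ℤ) : ℝ)) ≤ Z} := by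
    refine signCov_subset ?_ fun η => ?_
    -- The constraint is convex in `r`: the exponent is linear in `r` and `exp` is convex.
    · intro x hx y hy a c ha hc hac
      simp only [Set.mem_ofPred_eq] at hx hy ⊢
      have hlin : ∀ v : ι → ℝ, b * quadForm (w * (a • x + c • y)) v =
          a * (b * quadForm (w * x) v) + c * (b * quadForm (w * y) v) := by
        intro v
        simp only [quadForm, Pi.mul_apply, Pi.add_apply, Pi.smul_apply, smul_eq_mul,
          Finset.mul_sum, ← Finset.sum_add_distrib]
        refine Finset.sum_congr rfl fun i _ => Finset.sum_congr rfl fun j _ => by ring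
      calc _ ≤ ∑ τ : ι → ℤˣ, (a * Real.exp (b * quadForm (w * x) fun i => ((τ i : ℤ) : ℝ)) +
              c * Real.exp (b * quadForm (w * y) fun i => ((τ i : ℤ) : ℝ))) := by
            refine Finset.sum_le_sum fun τ _ => ?_
            rw [hlin]
            exact convexOn_exp.2 (Set.mem_univ _) (Set.mem_univ _) ha hc hac
        _ ≤ a * Z + c * Z := by
            rw [Finset.sum_add_distrib, ← Finset.mul_sum, ← Finset.mul_sum]
            gcongr
        _ = Z := by rw [← add_mul, hac, one_mul]
    · rw [Set.mem_ofPred_eq]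
      refine le_of_eq ?_
      -- A deterministic flip permutes the configurations, so equality holds.
      rw [hZ, ← Equiv.sum_comp (Equiv.mulLeft η)
        fun τ => Real.exp (b * quadForm w fun i => ((τ i : ℤ) : ℝ))]
      refine Finset.sum_congr rfl fun τ _ => ?_
      congr 2
      refine Finset.sum_congr rfl fun i _ => Finset.sum_congr rfl fun j _ => ?_
      simp
      ring
  exact this hr

/-! ### Random hyperplane cuts and the exponential kernel -/

/-- Separating points on a line by a uniformly distributed random point. -/
theorem one_sub_abs_mem_signCov {ι : Type*} [Finite ι] {R : ℝ} (hR : 0 < R) (a : ι → ℝ)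
    (ha : ∀ i, a i ∈ Set.Icc 0 R) : (fun i j => 1 - 2 / R * |a i - a j|) ∈ signCov ι := by
  have : Fintype ι := Fintype.ofFinite ι
  let η : ℝ → ι → ℤˣ := fun t i => if t < a i then 1 else -1
  let f : ℝ → ι → ι → ℝ := fun t i j => ((η t i : ℤ) : ℝ) * ((η t j : ℤ) : ℝ)
  have hmeas : ∀ i j, Measurable fun t => f t i j := by
    intro i j
    have hη : ∀ i, Measurable fun t => ((η t i : ℤ) : ℝ) := fun i =>
      (measurable_from_top (f := fun u : ℤˣ => ((u : ℤ) : ℝ))).comp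
        (Measurable.ite measurableSet_Iio measurable_const measurable_const)
    exact (hη i).mul (hη j)
  have hbd : ∀ t i j, |f t i j| ≤ 1 := fun t i j => by
    simp [f, abs_mul, abs_units]
  have hint : ∀ i j, IntegrableOn (fun t => f t i j) (Set.Ioc 0 R) := fun i j =>
    Measure.integrableOn_of_bounded (M := 1) (by simp) (hmeas i j).aestronglyMeasurable
      (Eventually.of_forall fun t => hbd t i j)
  have hint' : IntegrableOn f (Set.Ioc 0 R) :=
    Integrable.of_eval fun i => Integrable.of_eval fun j => hint i j
  have hmem := (convex_signCov ι).set_average_mem (isClosed_signCov ι)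
    (μ := volume) (t := Set.Ioc 0 R) (f := f) (by simp [hR]) (by simp)
    (Eventually.of_forall fun t => sign_mem_signCov (η t)) hint'
  convert hmem using 1
  ext i j
  have hval : ∀ i j, a i ≤ a j → ∫ t in Set.Ioc 0 R, f t i j = R - 2 * (a j - a i) := by
    intro i j hij
    -- The two signs differ exactly when the threshold `t` separates the points.
    have h1 : ∀ t, f t i j = 1 - 2 * (Set.Ico (a i) (a j)).indicator (fun _ => (1 : ℝ)) t := by
      intro t
      by_cases hi : t < a i
      · have hj := hi.trans_le hij
        simp [f, η, hi, hj, Set.indicator, not_le.mpr hi]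
      · by_cases hj : t < a j
        · simp [f, η, hi, hj, Set.indicator, not_lt.mp hi]
          norm_num
        · simp [f, η, hi, hj, Set.indicator]
    simp only [h1]
    have h2 : IntegrableOn ((Set.Ico (a i) (a j)).indicator (fun _ => (1 : ℝ))) (Set.Ioc 0 R) :=
      (integrable_indicator_iff measurableSet_Ico).mpr (by
        rw [IntegrableOn, Measure.restrict_restrict measurableSet_Ico]
        exact integrableOn_const (by
          refine ne_top_of_le_ne_top ?_ (measure_mono Set.inter_subset_right)
          simp))
    rw [integral_sub (by simp) (h2.const_mul 2), integral_const_mul,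
      integral_indicator measurableSet_Ico, Measure.restrict_restrict measurableSet_Ico,
      ← Measure.restrict_congr_set (Ioo_ae_eq_Ico.inter (ae_eq_refl (Set.Ioc 0 R))),
      Set.inter_eq_left.mpr]
    · simp [hR.le, hij]
    · exact fun t ht => ⟨(ha i).1.trans_lt ht.1, ht.2.le.trans (ha j).2⟩
  have hval' : ∫ t in Set.Ioc 0 R, f t i j = R - 2 * |a i - a j| := by
    rcases le_total (a i) (a j) with h | h
    · rw [hval i j h, abs_sub_comm, abs_of_nonneg (sub_nonneg.mpr h)]
    · rw [abs_of_nonneg (sub_nonneg.mpr h), ← hval j i h]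
      simp only [f, mul_comm]
  rw [setAverage_eq, Pi.smul_apply, Pi.smul_apply, eval_integral (fun i => hint'.eval i),
    eval_integral (fun j => (hint'.eval i).eval j), hval']
  simp [hR.le]
  field_simp

/-- The average is invariant under rotations and homogeneous in `x`, hence proportional to the norm.
-/
theorem exists_setAverage_abs_inner (E : Type*) [NormedAddCommGroup E] [InnerProductSpace ℝ E]
    [FiniteDimensional ℝ E] [MeasurableSpace E] [BorelSpace E] :
    ∃ c : ℝ, 0 < c ∧ ∀ x : E, ⨍ u in Metric.ball (0 : E) 1, |inner ℝ u x| = c * ‖x‖ := by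
  rcases subsingleton_or_nontrivial E with hE | hE
  · exact ⟨1, one_pos, fun x => by simp [Subsingleton.elim x 0]⟩
  obtain ⟨e, he⟩ := exists_norm_eq E (zero_le_one' ℝ)
  have hB : volume (Metric.ball (0 : E) 1) ≠ ⊤ := measure_ball_lt_top.ne
  have hB0 : 0 < volume.real (Metric.ball (0 : E) 1) :=
    ENNReal.toReal_pos (Metric.measure_ball_pos _ _ one_pos).ne' hB
  have hint : IntegrableOn (fun u : E => |inner ℝ u e|) (Metric.ball 0 1) :=
    Measure.integrableOn_of_bounded (M := 1) hB
      (Continuous.aestronglyMeasurable (by fun_prop))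
      (ae_restrict_of_forall_mem measurableSet_ball fun u hu => by
        rw [Real.norm_eq_abs, abs_abs]
        refine (abs_real_inner_le_norm u e).trans ?_
        rw [he, mul_one]
        exact (mem_ball_zero_iff.mp hu).le)
  have hpos : 0 < ∫ u in Metric.ball (0 : E) 1, |inner ℝ u e| := by
    rw [setIntegral_pos_iff_support_of_nonneg_ae (Eventually.of_forall fun u => abs_nonneg _) hint]
    -- The ball of radius `1 / 4` about `e / 2` stays inside the unit ball, and `⟨u, e⟩ > 1 / 4` on
    -- it.
    refine (Metric.measure_ball_pos volume ((1 / 2 : ℝ) • e) (by norm_num : (0 : ℝ) < 1 / 4)).trans_le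
      (measure_mono fun u hu => ?_)
    have hu' : ‖u - (1 / 2 : ℝ) • e‖ < 1 / 4 := by rwa [mem_ball_iff_norm] at hu
    have h1 : |inner ℝ (u - (1 / 2 : ℝ) • e) e| < 1 / 4 :=
      (abs_real_inner_le_norm _ _).trans_lt (by rwa [he, mul_one])
    rw [inner_sub_left, inner_smul_left, real_inner_self_eq_norm_sq, he] at h1
    constructor
    · rw [Function.mem_support]
      intro h0
      rw [abs_eq_zero.mp h0] at h1
      norm_num [abs_lt] at h1
    · rw [mem_ball_zero_iff]
      have h2 := norm_add_le (u - (1 / 2 : ℝ) • e) ((1 / 2 : ℝ) • e)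
      rw [sub_add_cancel, norm_smul, he] at h2
      norm_num at h2
      linarith
  refine ⟨⨍ u in Metric.ball (0 : E) 1, |inner ℝ u e|, ?_, fun x => ?_⟩
  · rw [setAverage_eq, smul_eq_mul]
    positivity
  · have hnorm : ‖x‖ = ‖‖x‖ • e‖ := by rw [norm_smul, he, norm_norm, mul_one]
    -- The reflection exchanging `x` and `‖x‖ • e` preserves volume and the unit ball.
    let ρ := (ℝ ∙ (x - ‖x‖ • e))ᗮ.reflection
    have hρ : ρ x = ‖x‖ • e := Submodule.reflection_sub hnorm
    have h1 := ρ.measurePreserving.setIntegral_preimage_emb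
      ρ.toHomeomorph.measurableEmbedding (fun u => |inner ℝ u (‖x‖ • e)|) (Metric.ball 0 1)
    have h2 : ρ ⁻¹' Metric.ball 0 1 = Metric.ball 0 1 := by
      ext u
      simp
    simp only [h2, ← hρ, LinearIsometryEquiv.inner_map_map] at h1
    rw [setAverage_eq, setAverage_eq, h1, hρ]
    simp only [inner_smul_right, abs_mul, abs_norm, integral_const_mul, smul_eq_mul]
    ring

/-- Cut the projections onto a random direction `u` at a random threshold. Averaging over `u` in the
unit ball turns `|⟨u, x i - x j⟩|` into a multiple of the norm. -/
theorem exists_one_sub_norm_mem_signCov {ι E : Type*} [Fintype ι] [NormedAddCommGroup E]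
    [InnerProductSpace ℝ E] [FiniteDimensional ℝ E] (x : ι → E) :
    ∃ c : ℝ, 0 < c ∧ (fun i j => 1 - c * ‖x i - x j‖) ∈ signCov ι := by
  borelize E
  obtain ⟨c, hc, hcx⟩ := exists_setAverage_abs_inner E
  set R : ℝ := 1 + ∑ i, ‖x i‖ with hR
  have hR0 : 0 < R := by positivity
  have hxR : ∀ i, ‖x i‖ ≤ R := fun i => by
    have := Finset.single_le_sum (f := fun i => ‖x i‖) (fun _ _ => norm_nonneg _) (Finset.mem_univ i)
    linarith
  have hB : volume (Metric.ball (0 : E) 1) ≠ ⊤ := measure_ball_lt_top.ne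
  have hB0 : volume (Metric.ball (0 : E) 1) ≠ 0 := (Metric.measure_ball_pos _ _ one_pos).ne'
  let f : E → ι → ι → ℝ := fun u i j => 1 - 1 / R * |inner ℝ u (x i - x j)|
  have hf : ∀ u ∈ Metric.ball (0 : E) 1, f u ∈ signCov ι := by
    intro u hu
    have hu' : ‖u‖ ≤ 1 := (mem_ball_zero_iff.mp hu).le
    have := one_sub_abs_mem_signCov (R := 2 * R) (by positivity) (fun i => inner ℝ u (x i) + R)
      (fun i => by
        have h1 : |inner ℝ u (x i)| ≤ R := (abs_real_inner_le_norm _ _).trans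
          ((mul_le_of_le_one_left (norm_nonneg _) hu').trans (hxR i))
        have h2 := abs_le.mp h1
        constructor <;> linarith)
    convert this using 4 with i j
    rw [inner_sub_right, add_sub_add_right_eq_sub]
    field_simp
  have hint : ∀ i j, IntegrableOn (fun u : E => |inner ℝ u (x i - x j)|) (Metric.ball 0 1) :=
    fun i j => ((Continuous.continuousOn (by fun_prop)).integrableOn_compact
      (isCompact_closedBall (0 : E) 1)).mono_set Metric.ball_subset_closedBall
  have hint1 : ∀ i j, IntegrableOn (fun u => f u i j) (Metric.ball 0 1) := fun i j =>
    (integrableOn_const hB).sub ((hint i j).const_mul _)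
  have hint' : IntegrableOn f (Metric.ball 0 1) :=
    Integrable.of_eval fun i => Integrable.of_eval fun j => hint1 i j
  have hmem := (convex_signCov ι).set_average_mem (isClosed_signCov ι) (μ := volume) hB0 hB
    (ae_restrict_of_forall_mem measurableSet_ball hf) hint'
  refine ⟨c / R, by positivity, ?_⟩
  convert hmem using 1
  ext i j
  rw [setAverage_eq, Pi.smul_apply, Pi.smul_apply, eval_integral (fun i => hint'.eval i),
    eval_integral (fun j => (hint'.eval i).eval j)]
  have h1 := hcx (x i - x j)
  rw [setAverage_eq, smul_eq_mul] at h1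
  have hv : volume.real (Metric.ball (0 : E) 1) ≠ 0 := (ENNReal.toReal_pos hB0 hB).ne'
  have h2 : Integrable (fun _ : E => (1 : ℝ)) (volume.restrict (Metric.ball 0 1)) :=
    integrableOn_const hB
  simp only [f]
  rw [integral_sub h2 ((hint i j).const_mul _), integral_const_mul]
  simp only [integral_const, measureReal_restrict_apply_univ, smul_eq_mul, mul_one, mul_sub]
  rw [inv_mul_cancel₀ hv, mul_left_comm, h1]
  ring

/-- The kernel `exp (-l |x - y|)` is the covariance of random signs. -/
theorem exp_neg_norm_mem_signCov {ι E : Type*} [Fintype ι] [NormedAddCommGroup E]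
    [InnerProductSpace ℝ E] [FiniteDimensional ℝ E] (x : ι → E) {l : ℝ} (hl : 0 ≤ l) :
    (fun i j => Real.exp (-l * ‖x i - x j‖)) ∈ signCov ι := by
  obtain ⟨c, hc, hmem⟩ := exists_one_sub_norm_mem_signCov x
  -- The exponential is the limit of `(1 - l |x - y| / n) ^ n`, a product of `n` independent cuts.
  refine (isClosed_signCov ι).mem_of_tendsto
    (f := fun n : ℕ => (fun (i j : ι) => (1 + (-l * ‖x i - x j‖) / n) ^ n)) (b := atTop)
    (tendsto_pi_nhds.mpr fun i => tendsto_pi_nhds.mpr fun j =>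
      Real.tendsto_one_add_div_pow_exp _) ?_
  obtain ⟨N, hN⟩ := exists_nat_gt (l / c)
  filter_upwards [eventually_ge_atTop (N + 1)] with n hn
  have hn0 : (0 : ℝ) < n := by exact_mod_cast (Nat.succ_pos N).trans_le hn
  have hNn : (N : ℝ) ≤ n := by exact_mod_cast (Nat.le_succ N).trans hn
  have ht : l / (c * n) ≤ 1 := by
    rw [← div_div]
    exact div_le_one_of_le₀ (hN.le.trans hNn) hn0.le
  -- Flipping nothing with probability `1 - l / (c n)` tunes the slope `c` down to `l / n`; this
  -- needs `n ≥ l / c`.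
  have h1 := convex_signCov ι (one_mem_signCov ι) hmem (sub_nonneg.mpr ht)
    (by positivity : 0 ≤ l / (c * n)) (by ring)
  convert pow_mem_signCov h1 n using 1
  ext i j
  simp only [Pi.pow_apply, Pi.add_apply, Pi.smul_apply, Pi.one_apply, smul_eq_mul]
  congr 1
  field_simp
  ring

end LongRangeIsing

noncomputable section

namespace LongRangeIsing

/-! ### A positive definite part of the coupling -/

/-- The function `(1 - exp (-l y)) / y`. -/
def expQuotient (l y : ℝ) : ℝ := ∫ u in Set.Ioc 0 l, Real.exp (-u * y)

/-- A truncation of `y ^ (1 - s)` that is bounded at the origin. -/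
def truncatedPower (s y : ℝ) : ℝ :=
  (Real.Gamma (s - 1))⁻¹ * ∫ a in Set.Ioc 0 1, a ^ (s - 2) * Real.exp (-a * y)

/-- A positive definite kernel that is close to `(1 - exp (-l |i - j|)) |i - j| ^ (-s)` off the
diagonal. -/
def smoothKernel {d : ℕ} (s l : ℝ) (i j : Site d) : ℝ :=
  expQuotient l (euclDist i j) * truncatedPower s (euclDist i j)

theorem expQuotient_nonneg (l y : ℝ) : 0 ≤ expQuotient l y :=
  setIntegral_nonneg measurableSet_Ioc fun _ _ => (Real.exp_pos _).le

theorem integrableOn_exp_neg_mul (l y : ℝ) :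
    IntegrableOn (fun u => Real.exp (-u * y)) (Set.Ioc 0 l) :=
  ((Continuous.continuousOn (by fun_prop)).integrableOn_Icc).mono_set Set.Ioc_subset_Icc_self

theorem expQuotient_zero {l : ℝ} (hl : 0 ≤ l) : expQuotient l 0 = l := by
  simp [expQuotient, hl]

theorem expQuotient_le {l y : ℝ} (hl : 0 ≤ l) (hy : 0 ≤ y) : expQuotient l y ≤ l := by
  refine (setIntegral_mono_on (integrableOn_exp_neg_mul l y) (integrableOn_exp_neg_mul l 0)
    measurableSet_Ioc fun u hu => ?_).trans_eq (expQuotient_zero hl)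
  have := mul_nonneg hu.1.le hy
  exact Real.exp_le_exp.mpr (by linarith)

theorem mul_expQuotient {l : ℝ} (hl : 0 ≤ l) (y : ℝ) :
    y * expQuotient l y = 1 - Real.exp (-l * y) := by
  rw [expQuotient, ← intervalIntegral.integral_of_le hl, ← intervalIntegral.integral_const_mul]
  have hderiv : ∀ u ∈ Set.uIcc 0 l,
      HasDerivAt (fun u => -Real.exp (-u * y)) (y * Real.exp (-u * y)) u := by
    intro u _
    have h1 : HasDerivAt (fun u : ℝ => -u * y) (-1 * y) u := ((hasDerivAt_id u).neg).mul_const y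
    exact h1.exp.neg.congr_deriv (by ring)
  rw [intervalIntegral.integral_eq_sub_of_hasDerivAt hderiv
    (Continuous.intervalIntegrable (by fun_prop) _ _)]
  simp
  ring

theorem truncatedPower_nonneg {s : ℝ} (hs : 1 < s) (y : ℝ) : 0 ≤ truncatedPower s y :=
  mul_nonneg (inv_nonneg.mpr (Real.Gamma_pos_of_pos (by linarith)).le)
    (setIntegral_nonneg measurableSet_Ioc fun a ha =>
      mul_nonneg (Real.rpow_nonneg ha.1.le _) (Real.exp_pos _).le)

theorem integrableOn_rpow_mul_exp_Ioc {s : ℝ} (hs : 1 < s) {y : ℝ} (hy : 0 ≤ y) :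
    IntegrableOn (fun a => a ^ (s - 2) * Real.exp (-a * y)) (Set.Ioc 0 1) := by
  have h1 : IntegrableOn (fun a : ℝ => a ^ (s - 2)) (Set.Ioc 0 1) :=
    (intervalIntegrable_iff_integrableOn_Ioc_of_le zero_le_one).mp
      (intervalIntegral.intervalIntegrable_rpow' (by linarith))
  refine Integrable.mono' h1 (by fun_prop) (ae_restrict_of_forall_mem measurableSet_Ioc
    fun a ha => ?_)
  rw [Real.norm_of_nonneg (mul_nonneg (Real.rpow_nonneg ha.1.le _) (Real.exp_pos _).le)]
  refine mul_le_of_le_one_right (Real.rpow_nonneg ha.1.le _) (Real.exp_le_one_iff.mpr ?_)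
  have := mul_nonneg ha.1.le hy
  linarith

theorem integrableOn_rpow_mul_exp_Ioi {p y : ℝ} (hp : 0 < p) (hy : 0 < y) :
    IntegrableOn (fun a => a ^ (p - 1) * Real.exp (-a * y)) (Set.Ioi 0) := by
  have := integrableOn_rpow_mul_exp_neg_mul_rpow (p := 1) (s := p - 1) (b := y)
    (by linarith) one_pos hy
  refine this.congr_fun (fun a _ => ?_) measurableSet_Ioi
  simp [mul_comm]

/-- The Gamma integral for `y ^ (1 - s)`, split at `a = 1`. -/
theorem truncatedPower_add_tail {s y : ℝ} (hs : 1 < s) (hy : 0 < y) :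
    truncatedPower s y + (Real.Gamma (s - 1))⁻¹ *
      ∫ a in Set.Ioi 1, a ^ (s - 2) * Real.exp (-a * y) = y ^ (1 - s) := by
  have hG := (Real.Gamma_pos_of_pos (by linarith : 0 < s - 1))
  have hint := integrableOn_rpow_mul_exp_Ioi (p := s - 1) (by linarith) hy
  rw [show s - 1 - 1 = s - 2 by ring] at hint
  have h1 := Real.integral_rpow_mul_exp_neg_mul_Ioi (a := s - 1) (by linarith) hy
  rw [show s - 1 - 1 = s - 2 by ring, ← Set.Ioc_union_Ioi_eq_Ioi zero_le_one] at h1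
  simp only [← mul_neg, mul_comm y] at h1
  simp only [mul_neg, ← neg_mul] at h1
  rw [setIntegral_union (Set.Ioc_disjoint_Ioi le_rfl) measurableSet_Ioi
    (hint.mono_set Set.Ioc_subset_Ioi_self) (hint.mono_set (Set.Ioi_subset_Ioi zero_le_one))] at h1
  rw [truncatedPower, ← mul_add, h1, one_div, Real.inv_rpow hy.le, ← Real.rpow_neg hy.le, neg_sub]
  field_simp

theorem truncatedPower_le {s y : ℝ} (hs : 1 < s) (hy : 0 < y) :
    truncatedPower s y ≤ y ^ (1 - s) := by
  rw [← truncatedPower_add_tail hs hy, le_add_iff_nonneg_right]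
  refine mul_nonneg (inv_nonneg.mpr (Real.Gamma_pos_of_pos (by linarith)).le)
    (setIntegral_nonneg measurableSet_Ioi fun a ha => mul_nonneg (Real.rpow_nonneg ?_ _)
      (Real.exp_pos _).le)
  exact zero_le_one.trans (le_of_lt ha)

/-- On the discarded tail `a ≥ 1`, so `a ^ (s - 2) ≤ a ^ (s - 1)`. Extending the latter integral to
all `a > 0` gives `Γ(s) y ^ (-s)`, and `Γ(s) = (s - 1) Γ(s - 1)`. -/
theorem rpow_le_truncatedPower_add {s y : ℝ} (hs : 1 < s) (hy : 0 < y) :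
    y ^ (1 - s) ≤ truncatedPower s y + (s - 1) * y ^ (-s) := by
  rw [← truncatedPower_add_tail hs hy, add_le_add_iff_left]
  have hG := (Real.Gamma_pos_of_pos (by linarith : 0 < s - 1))
  have hint := integrableOn_rpow_mul_exp_Ioi (p := s) (by linarith) hy
  have hint1 := integrableOn_rpow_mul_exp_Ioi (p := s - 1) (by linarith) hy
  rw [show s - 1 - 1 = s - 2 by ring] at hint1
  have h1 := Real.integral_rpow_mul_exp_neg_mul_Ioi (a := s) (by linarith) hy
  simp only [← mul_neg, mul_comm y] at h1
  simp only [mul_neg, ← neg_mul] at h1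
  have h2 : Real.Gamma s = (s - 1) * Real.Gamma (s - 1) := by
    have := Real.Gamma_add_one (s := s - 1) (by linarith)
    rwa [sub_add_cancel] at this
  rw [one_div, Real.inv_rpow hy.le, ← Real.rpow_neg hy.le, h2] at h1
  rw [inv_mul_le_iff₀ hG]
  calc _ ≤ ∫ a in Set.Ioi 1, a ^ (s - 1) * Real.exp (-a * y) := by
        refine setIntegral_mono_on (hint1.mono_set (Set.Ioi_subset_Ioi zero_le_one))
          (hint.mono_set (Set.Ioi_subset_Ioi zero_le_one)) measurableSet_Ioi fun a ha => ?_
        exact mul_le_mul_of_nonneg_right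
          (Real.rpow_le_rpow_of_exponent_le (le_of_lt ha) (by linarith)) (Real.exp_pos _).le
    _ ≤ ∫ a in Set.Ioi 0, a ^ (s - 1) * Real.exp (-a * y) := by
        refine setIntegral_mono_set hint (ae_restrict_of_forall_mem measurableSet_Ioi
          fun a ha => ?_) (Set.Ioi_subset_Ioi zero_le_one).eventuallyLE
        exact mul_nonneg (Real.rpow_nonneg (le_of_lt ha) _) (Real.exp_pos _).le
    _ = _ := by
        rw [h1]
        ring

/-! ### Positivity and bounds for the kernel -/

theorem smoothKernel_nonneg {d : ℕ} {s : ℝ} (hs : 1 < s) (l : ℝ) (i j : Site d) :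
    0 ≤ smoothKernel s l i j :=
  mul_nonneg (expQuotient_nonneg _ _) (truncatedPower_nonneg hs _)

theorem smoothKernel_sub {d : ℕ} (s l : ℝ) (i j : Site d) :
    smoothKernel s l (i - j) 0 = smoothKernel s l i j := by
  simp [smoothKernel, euclDist_sub]

theorem smoothKernel_self {d : ℕ} (s : ℝ) {l : ℝ} (hl : 0 ≤ l) (i : Site d) :
    smoothKernel s l i i = l * truncatedPower s 0 := by
  rw [smoothKernel, euclDist_self, expQuotient_zero hl]

theorem expQuotient_mul_rpow {l y : ℝ} (hl : 0 ≤ l) (hy : 0 < y) (s : ℝ) :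
    expQuotient l y * y ^ (1 - s) = (1 - Real.exp (-l * y)) * y ^ (-s) := by
  rw [← mul_expQuotient hl, show 1 - s = 1 + -s by ring, Real.rpow_add hy, Real.rpow_one]
  ring

theorem smoothKernel_le {d : ℕ} {s l : ℝ} (hs : 1 < s) (hl : 0 ≤ l) {i j : Site d} (h : i ≠ j) :
    smoothKernel s l i j ≤ (1 - Real.exp (-l * euclDist i j)) * longRange s i j := by
  have hy : 0 < euclDist i j := one_pos.trans_le (one_le_euclDist h)
  rw [longRange_of_ne s h, ← expQuotient_mul_rpow hl hy, smoothKernel]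
  exact mul_le_mul_of_nonneg_left (truncatedPower_le hs hy) (expQuotient_nonneg _ _)

theorem le_smoothKernel_add {d : ℕ} {s l : ℝ} (hs : 1 < s) (hl : 0 ≤ l) {i j : Site d}
    (h : i ≠ j) : (1 - Real.exp (-l * euclDist i j)) * longRange s i j ≤
      smoothKernel s l i j + l * (s - 1) * longRange s i j := by
  have hy : 0 < euclDist i j := one_pos.trans_le (one_le_euclDist h)
  rw [longRange_of_ne s h, ← expQuotient_mul_rpow hl hy, smoothKernel]
  refine (mul_le_mul_of_nonneg_left (rpow_le_truncatedPower_add hs hy)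
    (expQuotient_nonneg _ _)).trans ?_
  rw [mul_add, mul_assoc l]
  gcongr
  exact expQuotient_le hl hy.le

theorem smoothKernel_le_longRange {d : ℕ} {s l : ℝ} (hs : 1 < s) (hl : 0 ≤ l) {i j : Site d}
    (h : i ≠ j) : smoothKernel s l i j ≤ longRange s i j := by
  refine (smoothKernel_le hs hl h).trans (mul_le_of_le_one_left (longRange_nonneg s i j) ?_)
  linarith [Real.exp_pos (-l * euclDist i j)]

theorem summable_smoothKernel {d : ℕ} {s l : ℝ} (hs1 : 1 < s) (hs : (d : ℝ) < s) (hl : 0 ≤ l) :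
    Summable fun x : Site d => smoothKernel s l x 0 := by
  classical
  refine (((summable_longRange_zero hs).add ((hasSum_ite_eq (0 : Site d)
    (l * truncatedPower s 0)).summable))).of_nonneg_of_le
    (fun x => smoothKernel_nonneg hs1 l x 0) fun x => ?_
  by_cases h : x = 0
  · rw [h, smoothKernel_self s hl, longRange_self]
    simp
  · simpa [h] using smoothKernel_le_longRange hs1 hl h

theorem quadForm_integral_nonneg {ι : Type*} [Fintype ι] {S : Set ℝ} (hS : MeasurableSet S)
    {f : ℝ → ι → ι → ℝ} (hf : ∀ i j, IntegrableOn (fun t => f t i j) S) (v : ι → ℝ)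
    (hpos : ∀ t ∈ S, 0 ≤ quadForm (f t) v) :
    0 ≤ quadForm (fun i j => ∫ t in S, f t i j) v := by
  have h : quadForm (fun i j => ∫ t in S, f t i j) v = ∫ t in S, quadForm (f t) v := by
    simp only [quadForm]
    rw [integral_finsetSum _ fun i _ => integrable_finsetSum _ fun j _ =>
      ((hf i j).mul_const _).mul_const _]
    refine Finset.sum_congr rfl fun i _ => ?_
    rw [integral_finsetSum _ fun j _ => ((hf i j).mul_const _).mul_const _]
    refine Finset.sum_congr rfl fun j _ => ?_
    rw [integral_mul_const, integral_mul_const]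
  rw [h]
  exact setIntegral_nonneg hS hpos

theorem quadForm_const_mul {ι : Type*} [Fintype ι] (c : ℝ) (k : ι → ι → ℝ) (v : ι → ℝ) :
    quadForm (fun i j => c * k i j) v = c * quadForm k v := by
  simp only [quadForm, Finset.mul_sum, mul_assoc]

theorem exp_neg_euclDist_mem_signCov {d : ℕ} (Λ : Finset (Site d)) {l : ℝ} (hl : 0 ≤ l) :
    (fun i j : Λ => Real.exp (-l * euclDist (i : Site d) j)) ∈ signCov Λ := by
  simp only [euclDist_eq_norm]
  exact exp_neg_norm_mem_signCov (fun i : Λ => siteVec (i : Site d)) hl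

/-- Both factors of the kernel are mixtures of exponentials, so the kernel is a mixture of `exp (-(u
+ a) |i - j|)` with nonnegative weights, and each of these is a covariance. -/
theorem quadForm_smoothKernel_nonneg {d : ℕ} {s : ℝ} (hs : 1 < s) (l : ℝ)
    (Λ : Finset (Site d)) (v : Λ → ℝ) :
    0 ≤ quadForm (fun i j : Λ => smoothKernel s l (i : Site d) j) v := by
  have key : ∀ u ∈ Set.Ioc 0 l, 0 ≤ quadForm (fun i j : Λ =>
      ∫ a in Set.Ioc (0 : ℝ) 1, Real.exp (-u * euclDist (i : Site d) j) *
        (a ^ (s - 2) * Real.exp (-a * euclDist (i : Site d) j))) v := by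
    intro u hu
    refine quadForm_integral_nonneg measurableSet_Ioc (fun i j =>
      (integrableOn_rpow_mul_exp_Ioc hs (euclDist_nonneg _ _)).const_mul _) v fun a ha => ?_
    have h1 : (fun i j : Λ => Real.exp (-u * euclDist (i : Site d) j) *
        (a ^ (s - 2) * Real.exp (-a * euclDist (i : Site d) j))) =
        fun i j : Λ => a ^ (s - 2) * Real.exp (-(u + a) * euclDist (i : Site d) j) := by
      ext i j
      rw [mul_left_comm, ← Real.exp_add]
      congr 2
      ring
    rw [h1, quadForm_const_mul]
    exact mul_nonneg (Real.rpow_nonneg ha.1.le _) (quadForm_nonneg_of_mem_signCov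
      (exp_neg_euclDist_mem_signCov Λ (add_nonneg hu.1.le ha.1.le)) v)
  have h2 : (fun i j : Λ => smoothKernel s l (i : Site d) j) = fun i j : Λ =>
      (Real.Gamma (s - 1))⁻¹ * ∫ u in Set.Ioc 0 l, ∫ a in Set.Ioc (0 : ℝ) 1,
        Real.exp (-u * euclDist (i : Site d) j) *
          (a ^ (s - 2) * Real.exp (-a * euclDist (i : Site d) j)) := by
    ext i j
    simp only [integral_const_mul, integral_mul_const]
    rw [smoothKernel, expQuotient, truncatedPower]
    ring
  rw [h2, quadForm_const_mul]
  refine mul_nonneg (inv_nonneg.mpr (Real.Gamma_pos_of_pos (by linarith)).le)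
    (quadForm_integral_nonneg measurableSet_Ioc (fun i j => ?_) v key)
  simp only [integral_const_mul]
  exact (integrableOn_exp_neg_mul _ _).mul_const _

/-- The total mass of the kernel exceeds any given multiple of `l` if `l` is small. -/
theorem exists_le_tsum_smoothKernel {d : ℕ} (hd : 1 ≤ d) {s : ℝ}
    (hs : s ∈ Set.Ioc (d : ℝ) ((d : ℝ) + 1)) (T : ℝ) :
    ∃ l : ℝ, 0 < l ∧ l * T ≤ ∑' x : Site d, smoothKernel s l x 0 := by
  have hd1 : (1 : ℝ) ≤ d := by exact_mod_cast hd
  have hs1 : 1 < s := hd1.trans_lt hs.1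
  set κ := ∑' x : Site d, longRange s x 0 with hκ
  -- The upper bound `s ≤ d + 1` enters here.
  have hns := not_summable_euclDist_rpow hd (p := s - 1) (by linarith [hs.2])
  set f : Site d → ℝ := fun x => euclDist x 0 * longRange s x 0 with hf
  have hf0 : ∀ x, 0 ≤ f x := fun x => mul_nonneg (euclDist_nonneg _ _) (longRange_nonneg _ _ _)
  have hnf : ¬ Summable f := by
    intro h
    refine hns ((summable_congr_cofinite ?_).mp h)
    filter_upwards [(Set.finite_singleton (0 : Site d)).compl_mem_cofinite] with x hx
    have hx0 : x ≠ 0 := hx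
    have hy : 0 < euclDist x 0 := one_pos.trans_le (one_le_euclDist hx0)
    simp only [hf]
    rw [longRange_of_ne s hx0, show -(s - 1) = 1 + -s by ring, Real.rpow_add hy, Real.rpow_one]
  -- The extra `(s - 1) κ` pays for the truncation of the power. On the finite set `B`, `expQuotient
  -- l y / l → 1` as `l → 0`.
  obtain ⟨B, hB⟩ : ∃ B : Finset (Site d), T + (s - 1) * κ < ∑ x ∈ B, f x := by
    by_contra! hcon
    exact hnf (summable_of_sum_le hf0 hcon)
  have hlim : Tendsto (fun l : ℝ => ∑ x ∈ B, expQuotient l (euclDist x 0) / l * f x)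
      (𝓝[>] 0) (𝓝 (∑ x ∈ B, f x)) := by
    refine tendsto_finsetSum _ fun x _ => ?_
    by_cases hx : x = 0
    · simp [hf, hx, longRange_self]
    have hy : 0 < euclDist x 0 := one_pos.trans_le (one_le_euclDist hx)
    suffices h : Tendsto (fun l : ℝ => expQuotient l (euclDist x 0) / l) (𝓝[>] 0) (𝓝 1) by
      simpa using h.mul_const (f x)
    have h1 : HasDerivAt (fun l : ℝ => (1 - Real.exp (-l * euclDist x 0)) / euclDist x 0) 1 0 := by
      have h2 : HasDerivAt (fun l : ℝ => -l * euclDist x 0) (-1 * euclDist x 0) 0 :=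
        ((hasDerivAt_id (0 : ℝ)).neg).mul_const _
      exact ((h2.exp.const_sub 1).div_const (euclDist x 0)).congr_deriv (by simp [hy.ne'])
    have h3 := h1.tendsto_slope_zero_right
    refine h3.congr' ?_
    filter_upwards [self_mem_nhdsWithin] with l hl
    have := mul_expQuotient (le_of_lt hl) (euclDist x 0)
    simp only [zero_add, neg_zero, zero_mul, Real.exp_zero, sub_self, zero_div, sub_zero,
      smul_eq_mul, ← this]
    field_simp
  obtain ⟨l, hl, hl0⟩ := ((hlim.eventually (lt_mem_nhds hB)).and self_mem_nhdsWithin).exists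
  have hl0' : 0 < l := hl0
  refine ⟨l, hl0', ?_⟩
  have hterm : ∀ x : Site d, expQuotient l (euclDist x 0) * f x ≤
      smoothKernel s l x 0 + l * (s - 1) * longRange s x 0 := by
    intro x
    by_cases hx : x = 0
    · simp [hf, hx, longRange_self, smoothKernel_nonneg hs1]
    refine le_trans (le_of_eq ?_) (le_smoothKernel_add hs1 hl0'.le hx)
    rw [← mul_expQuotient hl0'.le]
    simp only [hf]
    ring
  have hsum : ∑ x ∈ B, expQuotient l (euclDist x 0) * f x ≤
      (∑' x : Site d, smoothKernel s l x 0) + l * (s - 1) * κ := by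
    refine (Finset.sum_le_sum fun x _ => hterm x).trans ?_
    rw [hκ, ← tsum_mul_left, ← (summable_smoothKernel hs1 hs.1 hl0'.le).tsum_add
      ((summable_longRange_zero hs.1).mul_left _)]
    refine Summable.sum_le_tsum _ (fun x _ => ?_) ((summable_smoothKernel hs1 hs.1 hl0'.le).add
      ((summable_longRange_zero hs.1).mul_left _))
    have := longRange_nonneg s x 0
    have := smoothKernel_nonneg hs1 l x 0
    have : 0 ≤ s - 1 := by linarith
    positivity
  have hB' : l * (T + (s - 1) * κ) ≤ ∑ x ∈ B, expQuotient l (euclDist x 0) * f x := by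
    rw [← le_div_iff₀' hl0', Finset.sum_div]
    refine hl.le.trans (le_of_eq (Finset.sum_congr rfl fun x _ => by ring))
  nlinarith

/-! ### The energy gained by random flips -/

/-- Expanding the nonnegative form at `τ - t` bounds the form at `τ` below by `∑ (2 t τ_i - t²)
D_i`, with `D_i` the row sums in `Λ`. Replacing each `D_i` by `g` yields `g t² |Λ|`; the defects `g
- D_i` are nonnegative and add up to at most a surface term. -/
theorem quadForm_smoothKernel_ge {d : ℕ} {s l : ℝ} (hs1 : 1 < s) (hs : (d : ℝ) < s) (hl : 0 ≤ l)
    (Λ : Finset (Site d)) (τ : Λ → ℤˣ) (t : ℝ) (ht : t * (Λ.card : ℝ) = ∑ i, ((τ i : ℤ) : ℝ)) :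
    (∑' x : Site d, smoothKernel s l x 0) * t ^ 2 * (Λ.card : ℝ) - surfaceCoupling s Λ ≤
      quadForm (fun i j : Λ => smoothKernel s l (i : Site d) j) fun i => ((τ i : ℤ) : ℝ) := by
  set g := ∑' x : Site d, smoothKernel s l x 0 with hg
  set v : Λ → ℝ := fun i => ((τ i : ℤ) : ℝ) with hv
  set D : Λ → ℝ := fun i => ∑ j : Λ, smoothKernel s l (i : Site d) j with hD
  have hsym : ∀ i j : Site d, smoothKernel s l i j = smoothKernel s l j i := fun i j => by
    rw [smoothKernel, smoothKernel, euclDist_comm]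
  have hsum : ∀ i : Site d, Summable fun j => smoothKernel s l i j := fun i =>
    ((Equiv.subLeft i).summable_iff.mpr (summable_smoothKernel hs1 hs hl)).congr fun j => by
      simp [smoothKernel_sub]
  have htsum : ∀ i : Site d, ∑' j, smoothKernel s l i j = g := fun i => by
    rw [hg, ← (Equiv.subLeft i).tsum_eq (fun x : Site d => smoothKernel s l x 0)]
    simp [smoothKernel_sub]
  have hDsum : ∀ i : Λ, D i = ∑ j ∈ Λ, smoothKernel s l (i : Site d) j := fun i =>
    Finset.sum_coe_sort Λ fun j => smoothKernel s l (i : Site d) j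
  have hDle : ∀ i, D i ≤ g := by
    intro i
    rw [← htsum i, hDsum]
    exact (hsum i).sum_le_tsum _ fun j _ => smoothKernel_nonneg hs1 l _ _
  have hDge : ∀ i, g - D i ≤ ∑' j, if j ∈ Λ then 0 else longRange s (i : Site d) j := by
    intro i
    have h1 : ∑ j ∈ Λ, smoothKernel s l (i : Site d) j +
        ∑' j : ((↑Λ : Set (Site d))ᶜ : Set (Site d)), smoothKernel s l (i : Site d) j = g :=
      ((hsum i).sum_add_tsum_subtype_compl Λ).trans (htsum i)
    rw [tsum_subtype ((↑Λ : Set (Site d))ᶜ) fun j => smoothKernel s l (i : Site d) j] at h1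
    have h2 : g - D i = ∑' j, ((↑Λ : Set (Site d))ᶜ).indicator
        (fun j => smoothKernel s l (i : Site d) j) j := by
      rw [hDsum, ← h1, add_sub_cancel_left]
    rw [h2]
    refine Summable.tsum_le_tsum (fun j => ?_) ((hsum i).indicator _)
      ((summable_longRange hs i).of_nonneg_of_le (fun j => ?_) fun j => ?_)
    · by_cases hj : j ∈ Λ
      · simp [hj]
      · have hij : (i : Site d) ≠ j := fun h => hj (h ▸ i.2)
        simpa [hj] using smoothKernel_le_longRange hs1 hl hij
    · split_ifs
      exacts [le_rfl, longRange_nonneg s _ _]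
    · split_ifs
      exacts [longRange_nonneg s _ _, le_rfl]
  have hS : ∑ i, (g - D i) ≤ surfaceCoupling s Λ := by
    rw [surfaceCoupling, ← Finset.sum_coe_sort Λ fun i => ∑' j, if j ∈ Λ then 0 else longRange s i j]
    exact Finset.sum_le_sum fun i _ => hDge i
  have hpos := quadForm_smoothKernel_nonneg hs1 l Λ fun i => v i - t
  have hexp : quadForm (fun i j : Λ => smoothKernel s l (i : Site d) j) (fun i => v i - t) =
      quadForm (fun i j : Λ => smoothKernel s l (i : Site d) j) v - ∑ i, (2 * t * v i - t ^ 2) * D i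
      := by
    have h1 : ∑ i : Λ, ∑ j : Λ, smoothKernel s l (i : Site d) j * v j = ∑ i, v i * D i := by
      rw [Finset.sum_comm]
      refine Finset.sum_congr rfl fun i _ => ?_
      rw [hD, Finset.mul_sum]
      exact Finset.sum_congr rfl fun j _ => by rw [hsym, mul_comm]
    have h2 : ∑ i, (2 * t * v i - t ^ 2) * D i =
        t * ∑ i, v i * D i + t * ∑ i, v i * D i - t ^ 2 * ∑ i, D i := by
      simp only [Finset.mul_sum, ← Finset.sum_add_distrib, ← Finset.sum_sub_distrib]
      exact Finset.sum_congr rfl fun i _ => by ring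
    rw [h2]
    nth_rewrite 1 [← h1]
    simp only [quadForm, hD, Finset.mul_sum, ← Finset.sum_add_distrib, ← Finset.sum_sub_distrib]
    exact Finset.sum_congr rfl fun i _ => Finset.sum_congr rfl fun j _ => by ring
  have hle : ∑ i, (2 * t * v i - t ^ 2) * (g - D i) ≤ ∑ i, (g - D i) := by
    refine Finset.sum_le_sum fun i _ => mul_le_of_le_one_left (sub_nonneg.mpr (hDle i)) ?_
    have h1 : v i * v i = 1 := units_sq (τ i)
    -- As `v_i² = 1`, `2 t v_i - t² = 1 - (t - v_i)² ≤ 1`.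
    nlinarith [sq_nonneg (t - v i)]
  have hmain : ∑ i, (2 * t * v i - t ^ 2) * (g - D i) =
      g * t ^ 2 * (Λ.card : ℝ) - ∑ i, (2 * t * v i - t ^ 2) * D i := by
    simp only [mul_sub, Finset.sum_sub_distrib, ← Finset.sum_mul, ← Finset.mul_sum]
    rw [← ht]
    simp
    ring
  linarith

open Classical in
/-- The coupling constants of the Hamiltonian `½ ∑ w(i,j) σ_i σ_j`. -/
def coupling {d : ℕ} (J s : ℝ) (i j : Site d) : ℝ :=
  longRange s i j - if IsNearestNeighbor i j then J else 0

/-- Three errors, each linear in `l` per site: the diagonal of the smooth kernel (the true one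
vanishes), the truncation of the power, and the nearest-neighbour term, where `1 - exp (-l) ≤ l`. -/
theorem quadForm_coupling_ge {d : ℕ} (J : ℝ) {s l : ℝ} (hs1 : 1 < s) (hs : (d : ℝ) < s)
    (hl : 0 ≤ l) (Λ : Finset (Site d)) (τ : Λ → ℤˣ) :
    quadForm (fun i j : Λ => smoothKernel s l (i : Site d) j) (fun i => ((τ i : ℤ) : ℝ)) -
      l * (truncatedPower s 0 + (s - 1 + |J|) * ∑' x : Site d, longRange s x 0) * (Λ.card : ℝ) ≤
    quadForm (fun i j : Λ => coupling J s (i : Site d) j *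
      (1 - Real.exp (-l * euclDist (i : Site d) j))) fun i => ((τ i : ℤ) : ℝ) := by
  classical
  set κ := ∑' x : Site d, longRange s x 0 with hκ
  have hterm : ∀ i j : Λ, smoothKernel s l (i : Site d) j * ((τ i : ℤ) : ℝ) * ((τ j : ℤ) : ℝ) -
      ((if i = j then l * truncatedPower s 0 else 0) +
        l * (s - 1 + |J|) * longRange s (i : Site d) j) ≤
      coupling J s (i : Site d) j * (1 - Real.exp (-l * euclDist (i : Site d) j)) *
        ((τ i : ℤ) : ℝ) * ((τ j : ℤ) : ℝ) := by
    intro i j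
    by_cases hij : i = j
    · subst hij
      rw [mul_assoc, units_sq, smoothKernel_self s hl, euclDist_self, longRange_self]
      simp
    have hij' : (i : Site d) ≠ j := fun h => hij (Subtype.ext h)
    set K := longRange s (i : Site d) j with hK
    set r := Real.exp (-l * euclDist (i : Site d) j) with hr
    set G := smoothKernel s l (i : Site d) j with hG
    have hK0 : 0 ≤ K := longRange_nonneg _ _ _
    have h1 : G ≤ (1 - r) * K := smoothKernel_le hs1 hl hij'
    have h2 : (1 - r) * K ≤ G + l * (s - 1) * K := le_smoothKernel_add hs1 hl hij'
    have h3 : |(if IsNearestNeighbor (i : Site d) j then J else 0) * (1 - r)| ≤ l * |J| * K := by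
      split_ifs with hn
      · have h4 : r = Real.exp (-l) := by rw [hr, hn.euclDist_eq_one, mul_one]
        have h5 := Real.add_one_le_exp (-l)
        have h6 : r ≤ 1 := h4 ▸ Real.exp_le_one_iff.mpr (by linarith)
        rw [hK, hn.longRange_eq_one, abs_mul, abs_of_nonneg (sub_nonneg.mpr h6), mul_one, mul_comm]
        refine mul_le_mul_of_nonneg_right ?_ (abs_nonneg J)
        linarith
      · rw [zero_mul, abs_zero]
        positivity
    have h7 := abs_le.mp h3
    have h8 : |((τ i : ℤ) : ℝ) * ((τ j : ℤ) : ℝ)| = 1 := by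
      rw [abs_mul, abs_units, abs_units, one_mul]
    rw [if_neg hij, zero_add, coupling, mul_assoc, mul_assoc _ ((τ i : ℤ) : ℝ)]
    rcases (abs_eq zero_le_one).mp h8 with h | h <;> rw [h] <;> linarith
  have hrow : ∀ i : Λ, ∑ j : Λ, longRange s (i : Site d) j ≤ κ := fun i => by
    rw [hκ, ← tsum_longRange s (i : Site d),
      Finset.sum_coe_sort Λ fun j => longRange s (i : Site d) j]
    exact (summable_longRange hs _).sum_le_tsum _ fun j _ => longRange_nonneg _ _ _
  have herr : ∑ i : Λ, ∑ j : Λ, ((if i = j then l * truncatedPower s 0 else 0) +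
      l * (s - 1 + |J|) * longRange s (i : Site d) j) ≤
      l * (truncatedPower s 0 + (s - 1 + |J|) * κ) * (Λ.card : ℝ) := by
    have : ∀ i : Λ, ∑ j : Λ, ((if i = j then l * truncatedPower s 0 else 0) +
        l * (s - 1 + |J|) * longRange s (i : Site d) j) ≤
        l * (truncatedPower s 0 + (s - 1 + |J|) * κ) := fun i => by
      rw [Finset.sum_add_distrib, Finset.sum_ite_eq, if_pos (Finset.mem_univ _), ← Finset.mul_sum]
      have h0 : 0 ≤ l * (s - 1 + |J|) := mul_nonneg hl (by linarith [abs_nonneg J])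
      linarith [mul_le_mul_of_nonneg_left (hrow i) h0]
    refine (Finset.sum_le_sum fun i _ => this i).trans_eq ?_
    simp
    ring
  refine (sub_le_sub_left herr _).trans ?_
  simp only [quadForm, ← Finset.sum_sub_distrib]
  exact Finset.sum_le_sum fun i _ => Finset.sum_le_sum fun j _ => hterm i j

/-! ### Boundary conditions -/

theorem hasSum_surfaceCoupling {d : ℕ} {s : ℝ} (hs : (d : ℝ) < s) (Λ : Finset (Site d)) :
    HasSum (fun p : Site d × Site d =>
      if p.1 ∈ Λ then if p.2 ∈ Λ then 0 else longRange s p.1 p.2 else 0) (surfaceCoupling s Λ) := by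
  have h0 : ∀ i j : Site d, 0 ≤ if j ∈ Λ then 0 else longRange s i j := fun i j => by
    split_ifs
    exacts [le_rfl, longRange_nonneg s i j]
  have h1 : ∀ i : Site d, Summable fun j => if j ∈ Λ then 0 else longRange s i j := fun i =>
    (summable_longRange hs i).of_nonneg_of_le (h0 i) fun j => by
      split_ifs
      exacts [longRange_nonneg s i j, le_rfl]
  have h2 : Summable fun p : Site d × Site d =>
      if p.1 ∈ Λ then if p.2 ∈ Λ then 0 else longRange s p.1 p.2 else 0 := by
    refine (summable_prod_of_nonneg fun p => ?_).mpr ⟨fun i => ?_, ?_⟩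
    · simp only [Pi.zero_apply]
      split_ifs
      exacts [le_rfl, longRange_nonneg s _ _, le_rfl]
    · by_cases hi : i ∈ Λ
      · simpa [hi] using h1 i
      · simp [hi, summable_zero]
    · refine summable_of_ne_finset_zero (s := Λ) fun i hi => ?_
      simp [hi]
  have h3 : surfaceCoupling s Λ = ∑' p : Site d × Site d,
      if p.1 ∈ Λ then if p.2 ∈ Λ then 0 else longRange s p.1 p.2 else 0 := by
    rw [h2.tsum_prod, tsum_eq_sum (s := Λ) fun i hi => by simp [hi]]
    exact Finset.sum_congr rfl fun i hi => by simp [hi]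
  rw [h3]
  exact h2.hasSum

theorem hasSum_comp_swap {α β : Type*} {f : α × β → ℝ} {a : ℝ} (h : HasSum f a) :
    HasSum (fun p : β × α => f p.swap) a :=
  (Equiv.prodComm β α).hasSum_iff.mpr h

/-- Up to a surface term, the energy in `Λ` does not depend on the boundary condition. -/
theorem abs_tsum_sub_quadForm_le {d : ℕ} {s : ℝ} (hs : (d : ℝ) < s) (Λ : Finset (Site d))
    {C : ℝ} {v : Site d → Site d → ℝ} (hv : ∀ i j, |v i j| ≤ C * longRange s i j)
    (σ : Config d) :
    |(∑' p : Site d × Site d, if p.1 ∈ Λ ∨ p.2 ∈ Λ then v p.1 p.2 * spin σ p.1 * spin σ p.2 else 0) -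
      quadForm (fun i j : Λ => v i j) (fun i => spin σ i)| ≤ 2 * (C * surfaceCoupling s Λ) := by
  set F : Site d × Site d → ℝ := fun p => v p.1 p.2 * spin σ p.1 * spin σ p.2 with hF
  set b : Site d × Site d → ℝ := fun p =>
    if p.1 ∈ Λ then if p.2 ∈ Λ then 0 else longRange s p.1 p.2 else 0 with hb
  -- Only pairs with exactly one site in `Λ` see the boundary condition; their two orders give the
  -- factor 2.
  set E : Site d × Site d → ℝ := fun p =>
    if p.1 ∈ Λ ∧ p.2 ∉ Λ ∨ p.1 ∉ Λ ∧ p.2 ∈ Λ then F p else 0 with hE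
  have hFle : ∀ p, |F p| ≤ C * longRange s p.1 p.2 := fun p => by
    simp only [hF, abs_mul, spin, abs_units, mul_one]
    exact hv _ _
  have hbsum := hasSum_surfaceCoupling hs Λ
  have hbswap : HasSum (fun p : Site d × Site d => b p.swap) (surfaceCoupling s Λ) :=
    hasSum_comp_swap hbsum
  have hEle : ∀ p, ‖E p‖ ≤ C * (b p + b p.swap) := fun p => by
    have h1 := hFle p
    have h2 := longRange_comm s p.1 p.2
    by_cases hp1 : p.1 ∈ Λ <;> by_cases hp2 : p.2 ∈ Λ <;>
      simp [hE, hb, hp1, hp2, h1, ← h2]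
  have hmaj := (hbsum.add hbswap).mul_left C
  have hEsum : Summable E := hmaj.summable.of_norm_bounded hEle
  have hin : HasSum (fun p => if p.1 ∈ Λ ∧ p.2 ∈ Λ then F p else 0)
      (quadForm (fun i j : Λ => v i j) (fun i => spin σ i)) := by
    have h1 : quadForm (fun i j : Λ => v i j) (fun i => spin σ i) =
        ∑ p ∈ Λ ×ˢ Λ, if p.1 ∈ Λ ∧ p.2 ∈ Λ then F p else 0 := by
      rw [Finset.sum_product, quadForm, ← Finset.sum_coe_sort Λ]
      refine Finset.sum_congr rfl fun i _ => ?_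
      rw [← Finset.sum_coe_sort Λ]
      exact Finset.sum_congr rfl fun j _ => by simp [hF]
    rw [h1]
    exact hasSum_sum_of_ne_finset_zero fun p hp => if_neg (by simpa using hp)
  have hsplit : (fun p : Site d × Site d =>
      if p.1 ∈ Λ ∨ p.2 ∈ Λ then v p.1 p.2 * spin σ p.1 * spin σ p.2 else 0) =
      fun p => (if p.1 ∈ Λ ∧ p.2 ∈ Λ then F p else 0) + E p := by
    ext p
    by_cases hp1 : p.1 ∈ Λ <;> by_cases hp2 : p.2 ∈ Λ <;> simp [hE, hF, hp1, hp2]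
  rw [hsplit, (hin.add hEsum.hasSum).tsum_eq, add_sub_cancel_left]
  refine (tsum_of_norm_bounded hmaj hEle).trans_eq ?_
  ring

/-- Since `longRange` equals 1 on nearest neighbours, `|J|` times it dominates the nearest-neighbour
coupling, and one surface term controls both parts. -/
theorem abs_hamiltonian_sub_le {d : ℕ} (J : ℝ) {s : ℝ} (hs : (d : ℝ) < s) (Λ : Finset (Site d))
    (σ : Config d) :
    |hamiltonian J s Λ σ -
      1 / 2 * quadForm (fun i j : Λ => coupling J s (i : Site d) j) (fun i => spin σ i)| ≤
      (1 + |J|) * surfaceCoupling s Λ := by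
  classical
  have h1 := abs_tsum_sub_quadForm_le hs Λ (C := 1) (v := longRange s)
    (fun i j => by rw [one_mul, abs_of_nonneg (longRange_nonneg s i j)]) σ
  have h2 := abs_tsum_sub_quadForm_le hs Λ (C := |J|)
    (v := fun i j => if IsNearestNeighbor i j then J else 0)
    (fun i j => by
      split_ifs with h
      · rw [h.longRange_eq_one, mul_one]
      · rw [abs_zero]
        exact mul_nonneg (abs_nonneg J) (longRange_nonneg s i j)) σ
  have h3 : (fun p : Site d × Site d => if p.1 ∈ Λ ∨ p.2 ∈ Λ then
      (if IsNearestNeighbor p.1 p.2 then J else 0) * spin σ p.1 * spin σ p.2 else 0) =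
      fun p => if IsNearestNeighbor p.1 p.2 ∧ (p.1 ∈ Λ ∨ p.2 ∈ Λ) then
        J * spin σ p.1 * spin σ p.2 else 0 := by
    ext p
    by_cases hn : IsNearestNeighbor p.1 p.2 <;> simp [hn]
  rw [h3] at h2
  have h4 : quadForm (fun i j : Λ => coupling J s (i : Site d) j) (fun i => spin σ i) =
      quadForm (fun i j : Λ => longRange s (i : Site d) j) (fun i => spin σ i) -
      quadForm (fun i j : Λ => if IsNearestNeighbor (i : Site d) j then J else 0)
        (fun i => spin σ i) := by
    simp only [quadForm, coupling, ← Finset.sum_sub_distrib]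
    exact Finset.sum_congr rfl fun i _ => Finset.sum_congr rfl fun j _ => by ring
  rw [hamiltonian, nearestNeighborEnergy, longRangeEnergy, h4]
  rw [abs_le] at h1 h2 ⊢
  constructor <;> linarith [h1.1, h1.2, h2.1, h2.2]

/-! ### Gibbs weight of configurations with large magnetization -/

theorem spin_glue {d : ℕ} {Λ : Finset (Site d)} (τ : Λ → ℤˣ) (σ : Config d) (i : Λ) :
    spin (glue τ σ) i = ((τ i : ℤ) : ℝ) := by
  simp [spin, glue]

/-- Configurations in `Λ` whose energy would increase by at least `q / 2` under averaging over
random flips are exponentially unlikely, whatever the boundary condition. -/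
theorem sum_gibbsProb_le {d : ℕ} (J : ℝ) {s l β : ℝ} (hs : (d : ℝ) < s) (hl : 0 ≤ l) (hβ : 0 ≤ β)
    (Λ : Finset (Site d)) (σ : Config d) (A : Finset (Λ → ℤˣ)) (q : ℝ)
    (hA : ∀ τ ∈ A, q ≤ quadForm (fun i j : Λ => coupling J s (i : Site d) j *
      (1 - Real.exp (-l * euclDist (i : Site d) j))) fun i => ((τ i : ℤ) : ℝ)) :
    ∑ τ ∈ A, gibbsProb J s β Λ τ σ ≤
      Real.exp (2 * β * ((1 + |J|) * surfaceCoupling s Λ) - β / 2 * q) := by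
  classical
  set B := (1 + |J|) * surfaceCoupling s Λ with hB
  set w : Λ → Λ → ℝ := fun i j => coupling J s (i : Site d) j with hw
  set r : Λ → Λ → ℝ := fun i j => Real.exp (-l * euclDist (i : Site d) j) with hr
  let v : (Λ → ℤˣ) → Λ → ℝ := fun τ i => ((τ i : ℤ) : ℝ)
  have hH : ∀ τ : Λ → ℤˣ, |hamiltonian J s Λ (glue τ σ) - 1 / 2 * quadForm w (v τ)| ≤ B := by
    intro τ
    have h := abs_hamiltonian_sub_le J hs Λ (glue τ σ)
    simpa only [spin_glue] using h
  have hflip := sum_exp_mul_signCov_le (-β / 2) w (exp_neg_euclDist_mem_signCov Λ hl)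
  have hZ : Real.exp (-β * B) * ∑ τ : Λ → ℤˣ, Real.exp (-β / 2 * quadForm w (v τ)) ≤
      partitionFunction J s β Λ σ := by
    rw [Finset.mul_sum, partitionFunction]
    refine Finset.sum_le_sum fun τ _ => ?_
    rw [← Real.exp_add, Real.exp_le_exp]
    have := mul_le_mul_of_nonneg_left (abs_le.mp (hH τ)).2 hβ
    linarith
  -- On `A`, passing from `w` to the averaged `w r` lowers the energy by at least `q / 2`. The
  -- boundary error `B` is paid here and once more in `hZ`, hence `2 β B`.
  have hup : ∑ τ ∈ A, Real.exp (-β * hamiltonian J s Λ (glue τ σ)) ≤ Real.exp (β * B - β / 2 * q) *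
      ∑ τ : Λ → ℤˣ, Real.exp (-β / 2 * quadForm (w * r) (v τ)) := by
    rw [Finset.mul_sum]
    refine (Finset.sum_le_sum fun τ hτ => ?_).trans (Finset.sum_le_sum_of_subset_of_nonneg
      (Finset.subset_univ A) fun τ _ _ => by positivity)
    rw [← Real.exp_add, Real.exp_le_exp]
    have h1 := mul_le_mul_of_nonneg_left (abs_le.mp (hH τ)).1 hβ
    have h2 := mul_le_mul_of_nonneg_left (hA τ hτ) (by positivity : 0 ≤ β / 2)
    have h3 : quadForm (fun i j : Λ => coupling J s (i : Site d) j *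
        (1 - Real.exp (-l * euclDist (i : Site d) j))) (v τ) =
        quadForm w (v τ) - quadForm (w * r) (v τ) := by
      simp only [quadForm, ← Finset.sum_sub_distrib, Pi.mul_apply]
      exact Finset.sum_congr rfl fun i _ => Finset.sum_congr rfl fun j _ => by ring
    rw [h3] at h2
    linarith
  have hZpos : 0 < partitionFunction J s β Λ σ :=
    Finset.sum_pos (fun _ _ => Real.exp_pos _) Finset.univ_nonempty
  simp only [gibbsProb, ← Finset.mul_sum]
  rw [inv_mul_le_iff₀ hZpos]
  calc _ ≤ Real.exp (β * B - β / 2 * q) *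
        ∑ τ : Λ → ℤˣ, Real.exp (-β / 2 * quadForm w (v τ)) :=
        hup.trans (mul_le_mul_of_nonneg_left hflip (Real.exp_pos _).le)
    _ = (Real.exp (-β * B) * ∑ τ : Λ → ℤˣ, Real.exp (-β / 2 * quadForm w (v τ))) *
        Real.exp (2 * β * B - β / 2 * q) := by
        rw [mul_right_comm, ← Real.exp_add]
        congr 2
        ring
    _ ≤ _ := mul_le_mul_of_nonneg_right hZ (Real.exp_pos _).le

/-- Exponential decay of large magnetizations, uniformly in the boundary condition. -/
theorem exists_sum_gibbsProb_le {d : ℕ} (hd : 1 ≤ d) {s : ℝ}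
    (hs : s ∈ Set.Ioc (d : ℝ) ((d : ℝ) + 1)) (J : ℝ) {β : ℝ} (hβ : 0 < β) {ε : ℝ} (hε : 0 < ε) :
    ∃ δ : ℝ, 0 < δ ∧ ∀ᶠ L : ℕ in atTop, ∀ (σ : Config d) (A : Finset (box d L → ℤˣ)),
      (∀ τ ∈ A, ε * ((box d L).card : ℝ) < |∑ i, ((τ i : ℤ) : ℝ)|) →
      ∑ τ ∈ A, gibbsProb J s β (box d L) τ σ ≤ Real.exp (-δ * ((box d L).card : ℝ)) := by
  have hd1 : (1 : ℝ) ≤ d := by exact_mod_cast hd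
  have hs1 : 1 < s := hd1.trans_lt hs.1
  set κ := ∑' x : Site d, longRange s x 0 with hκ
  have hκ0 : 0 ≤ κ := tsum_nonneg fun x => longRange_nonneg s x 0
  set C := truncatedPower s 0 + (s - 1 + |J|) * κ with hC
  have hC0 : 0 ≤ C := add_nonneg (truncatedPower_nonneg hs1 0)
    (mul_nonneg (by linarith [abs_nonneg J]) hκ0)
  -- With this choice `g t² ≥ l (C + 1)` whenever `|t| ≥ ε`: `C` absorbs the errors of
  -- `quadForm_coupling_ge` and 1 leaves a gain `l` per site.
  obtain ⟨l, hl, hlT⟩ := exists_le_tsum_smoothKernel hd hs ((C + 1) / ε ^ 2)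
  refine ⟨β * l / 4, by positivity, ?_⟩
  have hlim := tendsto_surfaceCoupling_box hs.1
  -- With `q = l n - S` the exponent is `β c S - β l n / 2`, and `c S ≤ l n / 4` leaves `-β l n /
  -- 4`.
  set c := 2 * (1 + |J|) + 1 / 2 with hc
  have hc0 : 0 < c := by positivity
  filter_upwards [hlim.eventually (gt_mem_nhds (by positivity : 0 < l / 4 / c))] with L hL σ A hA
  set n := ((box d L).card : ℝ) with hn
  have hn0 : 0 < n := by
    rw [hn, card_box]
    positivity
  set S := surfaceCoupling s (box d L) with hS
  have hSn : c * S ≤ l / 4 * n := by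
    rw [div_lt_div_iff₀ hn0 hc0] at hL
    linarith
  refine (sum_gibbsProb_le J hs.1 hl.le hβ.le (box d L) σ A (l * n - S) fun τ hτ => ?_).trans ?_
  · set t := (∑ i, ((τ i : ℤ) : ℝ)) / n with ht
    have ht' : t * n = ∑ i, ((τ i : ℤ) : ℝ) := div_mul_cancel₀ _ hn0.ne'
    have h1 := quadForm_smoothKernel_ge hs1 hs.1 hl.le (box d L) τ t ht'
    have h2 := quadForm_coupling_ge J hs1 hs.1 hl.le (box d L) τ
    have h3 : ε ≤ |t| := by
      rw [ht, abs_div, abs_of_pos hn0, le_div_iff₀ hn0]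
      exact (hA τ hτ).le
    have h4 : ε ^ 2 ≤ t ^ 2 := by
      rw [← sq_abs t]
      exact pow_le_pow_left₀ hε.le h3 2
    have h5 : l * (C + 1) ≤ (∑' x : Site d, smoothKernel s l x 0) * t ^ 2 := by
      calc l * (C + 1) = l * ((C + 1) / ε ^ 2) * ε ^ 2 := by field_simp
        _ ≤ (∑' x : Site d, smoothKernel s l x 0) * t ^ 2 :=
          mul_le_mul hlT h4 (by positivity) (tsum_nonneg fun x => smoothKernel_nonneg hs1 l x 0)
    have h6 := mul_le_mul_of_nonneg_right h5 hn0.le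
    refine le_trans ?_ h2
    linarith
  · rw [Real.exp_le_exp]
    have := mul_le_mul_of_nonneg_left hSn hβ.le
    rw [hc] at this
    linarith

end LongRangeIsing

end

namespace LongRangeIsing

/-! ### Infinite-volume Gibbs measures -/

theorem measurable_units_val : Measurable fun u : ℤˣ => (u : ℤ) := comap_measurable _

theorem measurable_spin {d : ℕ} (i : Site d) : Measurable fun σ : Config d => spin σ i :=
  (measurable_from_top (f := fun n : ℤ => (n : ℝ))).comp
    (measurable_units_val.comp (measurable_pi_apply i))

theorem abs_spin {d : ℕ} (σ : Config d) (i : Site d) : |spin σ i| = 1 := abs_units (σ i)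

theorem measurableSet_magnetization {d : ℕ} (Λ : Finset (Site d)) (a : ℝ) :
    MeasurableSet {ω : Config d | a < |∑ i ∈ Λ, spin ω i|} := by
  have h : Measurable fun ω : Config d => ∑ i ∈ Λ, spin ω i :=
    Finset.measurable_sum _ fun i _ => measurable_spin i
  exact measurableSet_lt measurable_const h.abs

theorem IsGibbsMeasure.condExp_eq_sum {d : ℕ} {J s β : ℝ} {μ : Measure (Config d)}
    (hμ : IsGibbsMeasure J s β μ) (Λ : Finset (Site d)) (A : Finset (Λ → ℤˣ)) :
    μ⟦{ω : Config d | (fun i : Λ => ω i) ∈ A} | exterior Λ⟧ =ᵐ[μ]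
      fun σ => ∑ τ ∈ A, gibbsProb J s β Λ τ σ := by
  have := hμ.isProbabilityMeasure
  have hmeas : ∀ τ : Λ → ℤˣ, MeasurableSet {σ : Config d | ∀ i : Λ, σ i = τ i} := fun τ => by
    have : {σ : Config d | ∀ i : Λ, σ i = τ i} =
        ⋂ i : Λ, (fun σ : Config d => (σ i : ℤ)) ⁻¹' {(τ i : ℤ)} := by
      ext
      simp [Units.ext_iff]
    rw [this]
    exact MeasurableSet.iInter fun i =>
      (measurable_units_val.comp (measurable_pi_apply (i : Site d))) (measurableSet_singleton _)
  have hind : {ω : Config d | (fun i : Λ => ω i) ∈ A}.indicator (fun _ => (1 : ℝ)) =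
      ∑ τ ∈ A, {σ : Config d | ∀ i : Λ, σ i = τ i}.indicator fun _ => (1 : ℝ) := by
    classical
    ext ω
    simp only [Finset.sum_apply, Set.indicator_apply, Set.mem_ofPred_eq]
    simp only [← funext_iff (f := fun i : Λ => ω i), Finset.sum_ite_eq]
  have hsum := condExp_finsetSum (μ := μ) (s := A)
    (f := fun τ => {σ : Config d | ∀ i : Λ, σ i = τ i}.indicator fun _ => (1 : ℝ))
    (fun τ _ => (integrable_const (1 : ℝ)).indicator (hmeas τ)) (exterior Λ)
  rw [hind]
  refine hsum.trans ?_
  have hall : ∀ᵐ σ ∂μ, ∀ τ ∈ A,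
      (μ⟦{σ : Config d | ∀ i : Λ, σ i = τ i} | exterior Λ⟧) σ = gibbsProb J s β Λ τ σ :=
    (Finset.eventually_all A).mpr fun τ _ => hμ.dlr Λ τ
  filter_upwards [hall] with σ hσ
  rw [Finset.sum_apply]
  exact Finset.sum_congr rfl hσ

/-! ### Conditional decay, almost sure limit and mean spin -/

theorem IsGibbsMeasure.exists_condExp_le {d : ℕ} (hd : 1 ≤ d) {s : ℝ}
    (hs : s ∈ Set.Ioc (d : ℝ) ((d : ℝ) + 1)) {J β : ℝ} (hβ : 0 < β) {μ : Measure (Config d)}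
    (hμ : IsGibbsMeasure J s β μ) {ε : ℝ} (hε : 0 < ε) :
    ∃ δ : ℝ, 0 < δ ∧ ∀ᶠ L : ℕ in atTop, ∀ᵐ σ ∂μ,
      (μ⟦{ω : Config d | ε * ((box d L).card : ℝ) < |∑ i ∈ box d L, spin ω i|} |
        exterior (box d L)⟧) σ ≤ Real.exp (-δ * ((box d L).card : ℝ)) := by
  classical
  obtain ⟨δ, hδ, h⟩ := exists_sum_gibbsProb_le hd hs J hβ hε
  refine ⟨δ, hδ, ?_⟩
  filter_upwards [h] with L hL
  let A : Finset (box d L → ℤˣ) :=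
    {τ | ε * ((box d L).card : ℝ) < |∑ i, ((τ i : ℤ) : ℝ)|}
  have hA : {ω : Config d | ε * ((box d L).card : ℝ) < |∑ i ∈ box d L, spin ω i|} =
      {ω : Config d | (fun i : box d L => ω i) ∈ A} := by
    ext ω
    simp only [A, Set.mem_ofPred_eq, Finset.mem_filter, Finset.mem_univ, true_and]
    rw [← Finset.sum_coe_sort (box d L) fun i => spin ω i]
    rfl
  rw [hA]
  filter_upwards [hμ.condExp_eq_sum (box d L) A] with σ hσ
  rw [hσ]
  exact hL σ A fun τ hτ => (Finset.mem_filter.mp hτ).2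

/-- Borel–Cantelli: integrating the conditional bound gives probabilities at most `exp (-δ |Λ_L|) ≤
exp (-δ L)`, which are summable. -/
theorem IsGibbsMeasure.ae_eventually_le {d : ℕ} (hd : 1 ≤ d) {s : ℝ}
    (hs : s ∈ Set.Ioc (d : ℝ) ((d : ℝ) + 1)) {J β : ℝ} (hβ : 0 < β) {μ : Measure (Config d)}
    (hμ : IsGibbsMeasure J s β μ) {ε : ℝ} (hε : 0 < ε) :
    ∀ᵐ σ ∂μ, ∀ᶠ L : ℕ in atTop, |∑ i ∈ box d L, spin σ i| ≤ ε * ((box d L).card : ℝ) := by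
  have := hμ.isProbabilityMeasure
  obtain ⟨δ, hδ, h⟩ := hμ.exists_condExp_le hd hs hβ hε
  obtain ⟨N, hN⟩ := eventually_atTop.mp h
  let A : ℕ → Set (Config d) := fun L =>
    {ω | ε * ((box d L).card : ℝ) < |∑ i ∈ box d L, spin ω i|}
  have hmeas : ∀ L, MeasurableSet (A L) := fun L => measurableSet_magnetization _ _
  have hcard : ∀ L : ℕ, (L : ℝ) ≤ (box d L).card := by
    intro L
    have h1 : L ≤ (2 * L + 1) ^ d :=
      (by omega : L ≤ 2 * L + 1).trans (Nat.le_self_pow (by omega) _)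
    rw [card_box]
    exact_mod_cast h1
  have hbound : ∀ L, N ≤ L → μ (A L) ≤ ENNReal.ofReal (Real.exp (-δ) ^ L) := by
    intro L hL
    rw [← ofReal_measureReal]
    refine ENNReal.ofReal_le_ofReal ?_
    have h1 : μ.real (A L) = ∫ σ, (μ⟦A L | exterior (box d L)⟧) σ ∂μ := by
      rw [integral_condExp (cylinderEvents_le_pi), integral_indicator_const _ (hmeas L)]
      simp
    rw [h1]
    refine (integral_mono_ae integrable_condExp (integrable_const _) (hN L hL)).trans ?_
    simp only [integral_const, probReal_univ, smul_eq_mul, one_mul]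
    rw [← Real.exp_nat_mul, Real.exp_le_exp]
    nlinarith [hcard L]
  have hsum : ∑' L, μ (A (L + N)) ≠ ⊤ := by
    have hgeo : Summable fun L : ℕ => Real.exp (-δ) ^ L :=
      summable_geometric_of_lt_one (Real.exp_pos _).le (Real.exp_lt_one_iff.mpr (by linarith))
    refine ne_top_of_le_ne_top ((summable_nat_add_iff N).mpr hgeo).tsum_ofReal_ne_top
      (ENNReal.tsum_le_tsum fun L => hbound _ (Nat.le_add_left N L))
  filter_upwards [ae_eventually_notMem hsum] with σ hσ
  obtain ⟨M, hM⟩ := eventually_atTop.mp hσ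
  filter_upwards [eventually_ge_atTop (M + N)] with L hL
  have h1 := hM (L - N) (by omega)
  rw [Nat.sub_add_cancel (by omega)] at h1
  exact not_lt.mp h1

theorem IsGibbsMeasure.ae_tendsto_average {d : ℕ} (hd : 1 ≤ d) {s : ℝ}
    (hs : s ∈ Set.Ioc (d : ℝ) ((d : ℝ) + 1)) {J β : ℝ} (hβ : 0 < β) {μ : Measure (Config d)}
    (hμ : IsGibbsMeasure J s β μ) :
    ∀ᵐ σ ∂μ, Tendsto (fun L : ℕ => 1 / ((box d L).card : ℝ) * ∑ i ∈ box d L, spin σ i)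
      atTop (𝓝 0) := by
  have hall : ∀ᵐ σ ∂μ, ∀ k : ℕ, ∀ᶠ L : ℕ in atTop,
      |∑ i ∈ box d L, spin σ i| ≤ 1 / ((k : ℝ) + 1) * ((box d L).card : ℝ) :=
    ae_all_iff.mpr fun k => hμ.ae_eventually_le hd hs hβ (by positivity)
  filter_upwards [hall] with σ hσ
  rw [Metric.tendsto_nhds]
  intro ε hε
  obtain ⟨k, hk⟩ := exists_nat_one_div_lt hε
  filter_upwards [hσ k] with L hL
  have hn : (0 : ℝ) < (box d L).card := by
    rw [card_box]
    positivity
  rw [Real.dist_eq, sub_zero, abs_mul, abs_of_pos (by positivity : 0 < 1 / ((box d L).card : ℝ)),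
    one_div_mul_eq_div]
  exact ((div_le_iff₀ hn).mpr hL).trans_lt hk

theorem IsTranslationInvariant.integral_spin_eq {d : ℕ} {μ : Measure (Config d)}
    (h : IsTranslationInvariant μ) (i : Site d) : ∫ σ, spin σ i ∂μ = ∫ σ, spin σ 0 ∂μ := by
  have hm : Measurable (shiftConfig i : Config d → Config d) :=
    measurable_pi_lambda _ fun j => measurable_pi_apply (j + i)
  conv_rhs => rw [← h i]
  rw [integral_map hm.aemeasurable (measurable_spin 0).aestronglyMeasurable]
  simp [spin, shiftConfig]

/-- By translation invariance the box averages all have the expectation of `spin σ 0`; they are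
bounded by 1 and tend to 0 almost surely. -/
theorem IsGibbsMeasure.integral_spin_eq_zero {d : ℕ} (hd : 1 ≤ d) {s : ℝ}
    (hs : s ∈ Set.Ioc (d : ℝ) ((d : ℝ) + 1)) {J β : ℝ} (hβ : 0 < β) {μ : Measure (Config d)}
    (hμ : IsGibbsMeasure J s β μ) (hinv : IsTranslationInvariant μ) :
    ∫ σ, spin σ 0 ∂μ = 0 := by
  have := hμ.isProbabilityMeasure
  have hn : ∀ L, (0 : ℝ) < (box d L).card := fun L => by
    rw [card_box]
    positivity
  have hlim := tendsto_integral_of_dominated_convergence (μ := μ)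
    (F := fun (L : ℕ) (σ : Config d) => 1 / ((box d L).card : ℝ) * ∑ i ∈ box d L, spin σ i)
    (f := fun _ => 0) (fun _ => (1 : ℝ))
    (fun L => ((Finset.measurable_sum _ fun i _ => measurable_spin i).const_mul
      _).aestronglyMeasurable)
    (integrable_const _) (fun L => Eventually.of_forall fun σ => by
      rw [Real.norm_eq_abs, abs_mul, abs_of_pos (by have := hn L; positivity), one_div_mul_eq_div,
        div_le_one (hn L)]
      refine (Finset.abs_sum_le_sum_abs _ _).trans_eq ?_
      simp [abs_spin])
    (hμ.ae_tendsto_average hd hs hβ)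
  have hint : ∀ i : Site d, Integrable (fun σ : Config d => spin σ i) μ := fun i =>
    (integrable_const (1 : ℝ)).mono' (measurable_spin i).aestronglyMeasurable
      (Eventually.of_forall fun σ => (abs_spin σ i).le)
  have hconst : ∀ L : ℕ, ∫ σ, 1 / ((box d L).card : ℝ) * ∑ i ∈ box d L, spin σ i ∂μ =
      ∫ σ, spin σ 0 ∂μ := fun L => by
    rw [integral_const_mul, integral_finsetSum _ fun i _ => hint i,
      Finset.sum_congr rfl fun i _ => hinv.integral_spin_eq i, Finset.sum_const, nsmul_eq_mul,
      ← mul_assoc, one_div_mul_cancel (hn L).ne', one_mul]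
  simp only [hconst, integral_zero] at hlim
  exact tendsto_nhds_unique tendsto_const_nhds hlim

end LongRangeIsing

theorem corollary2 (d : ℕ) (hd : 1 ≤ d) (s : ℝ) (hs : s ∈ Set.Ioc (d : ℝ) ((d : ℝ) + 1))
    (J β : ℝ) (hβ : 0 < β) (μ : Measure (Config d)) (hμ : IsGibbsMeasure J s β μ) :
    (∀ ε : ℝ, 0 < ε → ∃ δ : ℝ, 0 < δ ∧ ∀ᶠ L : ℕ in atTop, ∀ᵐ σ ∂μ,
      (μ⟦{ω : Config d | ε * ((box d L).card : ℝ) < |∑ i ∈ box d L, spin ω i|} |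
        exterior (box d L)⟧) σ ≤ Real.exp (-δ * ((box d L).card : ℝ))) ∧
    (∀ᵐ σ ∂μ, Tendsto (fun L : ℕ => 1 / ((box d L).card : ℝ) * ∑ i ∈ box d L, spin σ i)
      atTop (𝓝 0)) ∧
    (IsTranslationInvariant μ → ∫ σ, spin σ 0 ∂μ = 0) :=
  ⟨fun _ hε => hμ.exists_condExp_le hd hs hβ hε, hμ.ae_tendsto_average hd hs hβ,
    hμ.integral_spin_eq_zero hd hs hβ⟩
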